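/- Let $q\in L^1(\mathbb R)$ be real-valued with $\int_{\mathbb R}q(x)\,dx=0$, and let $q_m\ge 0$ be a constant such that $q(x)+q_m e^{-x^2}\ge 0$ for almost every $x\in\mathbb R$. Let $\lambda_0\le\lambda_1\le\lambda_2\le\cdots$ be the eigenvalues, listed with multiplicity, of the perturbed harmonic oscillator $$-u''(x)+[x^2+q(x)]\,u(x)=\lambda u(x),\qquad x\in\mathbb R,$$ i.e. of the operator on $L^2(\mathbb R)$ associated with the quadratic form $\int_{\mathbb R} (u')^2+(x^2+q)u^2\,dx$ on $H^1(\mathbb R)\cap L^2(\mathbb R,|x^2+q|\,dx)$, and suppose that $\lambda_0>0$, so that the negative powers below are defined. Let $\lambda_k^0=2k+1$, let $$\omega_n=\begin{cases}\dfrac{2n+3}{n+1}\,\dfrac{\Gamma(\frac n2+1)}{\Gamma(\frac{n+1}2)}, & n\text{ odd},\\[2ex](n+1)\,\dfrac{\Gamma(\frac{n+1}2)}{\Gamma(\frac n2+1)}, & n\text{ even},\end{cases}\qquad \varepsilon_n=\omega_n-\sqrt2\,\frac{\Gamma(n+\frac32)}{\Gamma(n+1)}\quad(n\ge 0),$$ and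 $\varepsilon_{-1}=0$. Then for all integers $n\ge 0$ and all real $s>0$, $$\sum_{k=0}^n\lambda_k^{-s}\;\ge\;\sum_{k=0}^n(\lambda_k^0)^{-s}-s\,q_m\sum_{k=0}^n(\lambda_k^0)^{-s-1}(\varepsilon_k-\varepsilon_{k-1}).$$ -/

import Mathlib

open MeasureTheory

noncomputable section

namespace PerturbedOscillator

/-- The form domain `H¹(ℝ) ∩ L²(ℝ, |V| dx)` of the Schrödinger operator `-d²/dx² + V`.
A function in `H¹(ℝ)` is represented by its (unique) continuous representative, which is locally
absolutely continuous; its weak derivative is then the classical derivative `deriv u`, which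
exists almost everywhere. -/
structure InFormDomain (V u : ℝ → ℝ) : Prop where
  absolutelyContinuous : ∀ a b : ℝ, AbsolutelyContinuousOnInterval u a b
  memLp : MemLp u 2 volume
  memLp_deriv : MemLp (deriv u) 2 volume
  integrable_potential : Integrable (fun x => V x * u x ^ 2) volume

/-- `u` is a solution in `L²(ℝ)` of `-u'' + V u = μ u` in the form sense: `u` is in the form
domain, and `∫ u' φ' + ∫ V u φ = μ ∫ u φ` for every `φ` in the form domain. (The integrability
of `V u φ` follows from the Cauchy–Schwarz inequality when `V` is measurable.) -/
structure IsEigenSolution (V : ℝ → ℝ) (μ : ℝ) (u : ℝ → ℝ) : Prop where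
  inFormDomain : InFormDomain V u
  integrable_mul : ∀ φ, InFormDomain V φ → Integrable (fun x => V x * u x * φ x) volume
  weak_eq : ∀ φ, InFormDomain V φ →
    (∫ x, deriv u x * deriv φ x) + (∫ x, V x * u x * φ x) = μ * ∫ x, u x * φ x

theorem deriv_add_ae {u v : ℝ → ℝ}
    (hu : ∀ a b : ℝ, AbsolutelyContinuousOnInterval u a b)
    (hv : ∀ a b : ℝ, AbsolutelyContinuousOnInterval v a b) :
    deriv (u + v) =ᵐ[volume] deriv u + deriv v := by
  have key : ∀ {w : ℝ → ℝ}, (∀ a b : ℝ, AbsolutelyContinuousOnInterval w a b) →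
      ∀ᵐ x, DifferentiableAt ℝ w x := by
    intro w hw
    have h : ∀ᵐ x : ℝ, ∀ n : ℕ, x ∈ Set.uIcc (-(n : ℝ)) n → DifferentiableAt ℝ w x :=
      ae_all_iff.2 fun n => (hw (-(n : ℝ)) n).ae_differentiableAt
    filter_upwards [h] with x hx
    obtain ⟨n, hn⟩ := exists_nat_ge |x|
    refine hx n ?_
    rw [Set.uIcc_of_le (by linarith [abs_nonneg x])]
    exact abs_le.1 hn
  filter_upwards [key hu, key hv] with x hx hy
  exact deriv_add hx hy

theorem deriv_smul_eq (c : ℝ) (u : ℝ → ℝ) : deriv (c • u) = c • deriv u := by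
  ext x
  simp [deriv_const_smul_field]

theorem IsEigenSolution.zero (V : ℝ → ℝ) (μ : ℝ) : IsEigenSolution V μ 0 where
  inFormDomain :=
    { absolutelyContinuous := fun a b => by
        simpa using! (LipschitzOnWith.absolutelyContinuousOnInterval (K := 0)
          (f := fun _ : ℝ => (0 : ℝ)) (a := a) (b := b) (by
            intro x _ y _
            simp))
      memLp := MemLp.zero
      memLp_deriv := by
        have : deriv (0 : ℝ → ℝ) = 0 := by
          ext x
          exact deriv_const x 0
        rw [this]
        exact MemLp.zero
      integrable_potential := by simp }
  integrable_mul := fun φ _ => by simp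
  weak_eq := fun φ _ => by
    have : deriv (0 : ℝ → ℝ) = 0 := by
      ext x
      exact deriv_const x 0
    simp [this]

theorem IsEigenSolution.add {V : ℝ → ℝ} {μ : ℝ} {u v : ℝ → ℝ}
    (hu : IsEigenSolution V μ u) (hv : IsEigenSolution V μ v) :
    IsEigenSolution V μ (u + v) where
  inFormDomain :=
    { absolutelyContinuous := fun a b =>
        (hu.inFormDomain.absolutelyContinuous a b).add (hv.inFormDomain.absolutelyContinuous a b)
      memLp := hu.inFormDomain.memLp.add hv.inFormDomain.memLp
      memLp_deriv := (memLp_congr_ae (deriv_add_ae hu.inFormDomain.absolutelyContinuous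
        hv.inFormDomain.absolutelyContinuous)).2
          (hu.inFormDomain.memLp_deriv.add hv.inFormDomain.memLp_deriv)
      integrable_potential := by
        have h := (hu.inFormDomain.integrable_potential.add
          hv.inFormDomain.integrable_potential).add
          ((hu.integrable_mul v hv.inFormDomain).const_mul 2)
        refine h.congr (Filter.Eventually.of_forall fun x => ?_)
        simp only [Pi.add_apply]
        ring }
  integrable_mul := fun φ hφ => by
    refine ((hu.integrable_mul φ hφ).add (hv.integrable_mul φ hφ)).congr
      (Filter.Eventually.of_forall fun x => ?_)
    simp only [Pi.add_apply]
    ring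
  weak_eq := fun φ hφ => by
    have h1 : ∫ x, deriv (u + v) x * deriv φ x =
        (∫ x, deriv u x * deriv φ x) + ∫ x, deriv v x * deriv φ x := by
      have i1 : Integrable (fun x => deriv u x * deriv φ x) :=
        hu.inFormDomain.memLp_deriv.integrable_mul hφ.memLp_deriv
      have i2 : Integrable (fun x => deriv v x * deriv φ x) :=
        hv.inFormDomain.memLp_deriv.integrable_mul hφ.memLp_deriv
      rw [← integral_add i1 i2]
      refine integral_congr_ae ?_
      filter_upwards [deriv_add_ae hu.inFormDomain.absolutelyContinuous
        hv.inFormDomain.absolutelyContinuous] with x hx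
      rw [hx, Pi.add_apply]
      ring
    have h2 : ∫ x, V x * (u + v) x * φ x =
        (∫ x, V x * u x * φ x) + ∫ x, V x * v x * φ x := by
      rw [← integral_add (hu.integrable_mul φ hφ) (hv.integrable_mul φ hφ)]
      congr 1
      ext x
      simp only [Pi.add_apply]
      ring
    have h3 : ∫ x, (u + v) x * φ x = (∫ x, u x * φ x) + ∫ x, v x * φ x := by
      have i1 : Integrable (fun x => u x * φ x) :=
        hu.inFormDomain.memLp.integrable_mul hφ.memLp
      have i2 : Integrable (fun x => v x * φ x) :=
        hv.inFormDomain.memLp.integrable_mul hφ.memLp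
      rw [← integral_add i1 i2]
      congr 1
      ext x
      simp only [Pi.add_apply]
      ring
    rw [h1, h2, h3, mul_add, ← hu.weak_eq φ hφ, ← hv.weak_eq φ hφ]
    ring

theorem IsEigenSolution.smul {V : ℝ → ℝ} {μ : ℝ} {u : ℝ → ℝ} (c : ℝ)
    (hu : IsEigenSolution V μ u) : IsEigenSolution V μ (c • u) where
  inFormDomain :=
    { absolutelyContinuous := fun a b => (hu.inFormDomain.absolutelyContinuous a b).const_smul c
      memLp := hu.inFormDomain.memLp.const_smul c
      memLp_deriv := by
        rw [deriv_smul_eq]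
        exact hu.inFormDomain.memLp_deriv.const_smul c
      integrable_potential := by
        refine (hu.inFormDomain.integrable_potential.const_mul (c ^ 2)).congr
          (Filter.Eventually.of_forall fun x => ?_)
        simp only [Pi.smul_apply, smul_eq_mul]
        ring }
  integrable_mul := fun φ hφ => by
    refine ((hu.integrable_mul φ hφ).const_mul c).congr
      (Filter.Eventually.of_forall fun x => ?_)
    simp only [Pi.smul_apply, smul_eq_mul]
    ring
  weak_eq := fun φ hφ => by
    have h1 : ∫ x, deriv (c • u) x * deriv φ x = c * ∫ x, deriv u x * deriv φ x := by
      rw [← integral_const_mul, deriv_smul_eq]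
      congr 1
      ext x
      simp only [Pi.smul_apply, smul_eq_mul]
      ring
    have h2 : ∫ x, V x * (c • u) x * φ x = c * ∫ x, V x * u x * φ x := by
      rw [← integral_const_mul]
      congr 1
      ext x
      simp only [Pi.smul_apply, smul_eq_mul]
      ring
    have h3 : ∫ x, (c • u) x * φ x = c * ∫ x, u x * φ x := by
      rw [← integral_const_mul]
      congr 1
      ext x
      simp only [Pi.smul_apply, smul_eq_mul]
      ring
    rw [h1, h2, h3, ← mul_add, hu.weak_eq φ hφ]
    ring

/-- The eigenspace `ker (H - μ)` of the Schrödinger operator `H = -d²/dx² + V`; it is the zero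
space when `μ` is not an eigenvalue. -/
def eigenspace (V : ℝ → ℝ) (μ : ℝ) : Submodule ℝ (ℝ → ℝ) where
  carrier := {u | IsEigenSolution V μ u}
  zero_mem' := IsEigenSolution.zero V μ
  add_mem' := fun hu hv => hu.add hv
  smul_mem' := fun c _ hu => hu.smul c

/-- `lam 0 ≤ lam 1 ≤ …` is the list of all eigenvalues of `-d²/dx² + V`, in non-decreasing order,
each real number being listed exactly as many times as the dimension of its eigenspace. -/
structure IsEigenvalueSequence (V : ℝ → ℝ) (lam : ℕ → ℝ) : Prop where
  monotone : Monotone lam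
  multiplicity : ∀ μ : ℝ,
    Set.encard {k : ℕ | lam k = μ} = Cardinal.toENat (Module.rank ℝ (eigenspace V μ))

/-- The potential of the perturbed harmonic oscillator. -/
def potential (q : ℝ → ℝ) (x : ℝ) : ℝ := x ^ 2 + q x

/-- The eigenvalues `2k + 1` of the quantum harmonic oscillator. -/
def lamZero (k : ℕ) : ℝ := 2 * k + 1

/-- The sequence `ω_n`. -/
def omega (n : ℕ) : ℝ :=
  if Odd n then
    (2 * n + 3 : ℝ) / (n + 1) * (Real.Gamma ((n : ℝ) / 2 + 1) / Real.Gamma (((n : ℝ) + 1) / 2))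
  else
    ((n : ℝ) + 1) * (Real.Gamma (((n : ℝ) + 1) / 2) / Real.Gamma ((n : ℝ) / 2 + 1))

/-- The sequence `ε_n = ω_n - √2 Γ(n + 3/2) / Γ(n + 1)`. -/
def eps (n : ℕ) : ℝ :=
  omega n - Real.sqrt 2 * (Real.Gamma ((n : ℝ) + 3 / 2) / Real.Gamma ((n : ℝ) + 1))

/-- `epsPrev k` is `ε_{k-1}`, with the convention `ε_{-1} = 0`. -/
def epsPrev : ℕ → ℝ
  | 0 => 0
  | k + 1 => eps k

end PerturbedOscillator

end

/-! The proof is a trial-function argument followed by convexity. By the Ky Fan principle, the sum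
of the lowest `n + 1` eigenvalues is at most the sum of the energies of any `n + 1` orthonormal
trial functions. For the Hermite functions `ψ_k`, that sum is `∑ (2k + 1) + ∫ q ρ_n`, with `ρ_n =
∑_{k ≤ n} ψ_k²`.

The bound on `∫ q ρ_n` rests on two facts. First, `ρ_n ≤ ω_n / π`: by Christoffel–Darboux the
derivative of `ρ_n + ψ_{n+1}² / 2` is `-x ψ_{n+1}²`, so this function peaks at the origin, where its
value is `ω_n / π`. Second, `∫ exp(-x²) ρ_n` is an explicit quotient of Gamma values. Multiplying `q
+ q_m exp(-x²) ≥ 0` by `ρ_n ≤ ω_n / π` and integrating, with `∫ q = 0`, gives `∫ q ρ_n ≤ q_m ε_n /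
√π ≤ q_m ε_n`. Hence `∑_{k ≤ n} (λ_k - λ_k⁰) ≤ q_m ε_n` for every `n` (`sum_lam_sub_lamZero_le`).

The tangent to the convex function `x ↦ x^(-s)` at `λ_k⁰` bounds `λ_k^(-s)` below, with slope `-s
(λ_k⁰)^(-s-1)`. The weights `(λ_k⁰)^(-s-1)` decrease in `k`, so Abel summation carries the
partial-sum bounds over to the weighted sum.

Since eigenvalues are specified only through dimensions of eigenspaces, the Ky Fan principle needs
an existence argument. The form has compact sublevel sets, successive minimization produces
eigenpairs `(e_k, m_k)`, and counting multiplicities gives `λ_k ≤ m_k`. Only this one inequality is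
needed. -/

open MeasureTheory

noncomputable section

namespace PerturbedOscillator

open Filter Topology

/-! ### Variational theory of semibounded forms with compact sublevel sets -/

section Variational

variable {E : Type*} [AddCommGroup E] [Module ℝ E]

/-- A lower semibounded symmetric form `a`, closed and with compact resolvent relative to the
inner product `b`. -/
structure IsCompactForm (a b : E →ₗ[ℝ] E →ₗ[ℝ] ℝ) (C : ℝ) : Prop where
  symm_a : ∀ u v, a u v = a v u
  symm_b : ∀ u v, b u v = b v u
  pos_b : ∀ u, u ≠ 0 → 0 < b u u
  le_add : ∀ u, b u u ≤ a u u + C * b u u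
  compact : ∀ (u : ℕ → E) (M : ℝ), (∀ n, a (u n) (u n) + C * b (u n) (u n) ≤ M) →
    ∃ φ : ℕ → ℕ, StrictMono φ ∧
      Tendsto (fun p : ℕ × ℕ => b (u (φ p.1) - u (φ p.2)) (u (φ p.1) - u (φ p.2))) atTop (𝓝 0)
  complete : ∀ u : ℕ → E,
    Tendsto (fun p : ℕ × ℕ => a (u p.1 - u p.2) (u p.1 - u p.2)
      + C * b (u p.1 - u p.2) (u p.1 - u p.2)) atTop (𝓝 0) →
    ∃ v, Tendsto (fun n => a (u n - v) (u n - v) + C * b (u n - v) (u n - v)) atTop (𝓝 0)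

/-- Cauchy–Schwarz for the semidefinite form `c`; it shows in particular that orthogonality
conditions survive limits. -/
theorem tendsto_form_right {c : E →ₗ[ℝ] E →ₗ[ℝ] ℝ} (hs : ∀ u v, c u v = c v u)
    (hp : ∀ u, 0 ≤ c u u) {u : ℕ → E} {v : E}
    (h : Tendsto (fun n => c (u n - v) (u n - v)) atTop (𝓝 0)) (w : E) :
    Tendsto (fun n => c w (u n)) atTop (𝓝 (c w v)) := by
  have h1 : Tendsto (fun n => c w (u n - v)) atTop (𝓝 0) := by
    have h2 : Tendsto (fun n => Real.sqrt (c w w * c (u n - v) (u n - v))) atTop (𝓝 0) := by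
      simpa using (h.const_mul (c w w)).sqrt
    refine squeeze_zero_norm (fun n => ?_) h2
    rw [Real.norm_eq_abs]
    refine Real.abs_le_sqrt ?_
    have := LinearMap.BilinForm.apply_mul_apply_le_of_forall_zero_le c hp w (u n - v)
    rw [hs (u n - v) w] at this
    nlinarith
  have := h1.add_const (c w v)
  simpa [map_sub] using this

theorem tendsto_form_self {c : E →ₗ[ℝ] E →ₗ[ℝ] ℝ} (hs : ∀ u v, c u v = c v u)
    (hp : ∀ u, 0 ≤ c u u) {u : ℕ → E} {v : E}
    (h : Tendsto (fun n => c (u n - v) (u n - v)) atTop (𝓝 0)) :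
    Tendsto (fun n => c (u n) (u n)) atTop (𝓝 (c v v)) := by
  have h1 := tendsto_form_right hs hp h v
  have h2 := (h.add (h1.const_mul 2)).sub_const (c v v)
  have e : (0 : ℝ) + 2 * c v v - c v v = c v v := by ring
  rw [e] at h2
  refine h2.congr fun n => ?_
  simp only [map_sub, LinearMap.sub_apply]
  rw [hs (u n) v]
  ring

namespace IsCompactForm

variable {a b : E →ₗ[ℝ] E →ₗ[ℝ] ℝ} {C : ℝ}

theorem nonneg_b (h : IsCompactForm a b C) (u : E) : 0 ≤ b u u := by
  by_cases hu : u = 0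
  · simp [hu]
  · exact (h.pos_b u hu).le

/-- The quotient `a / b` attains its infimum on every nonzero `b`-closed subspace. -/
theorem exists_minimizer (h : IsCompactForm a b C) (S : Submodule ℝ E)
    (hS : ∀ (u : ℕ → E) (v : E), (∀ n, u n ∈ S) →
      Tendsto (fun n => b (u n - v) (u n - v)) atTop (𝓝 0) → v ∈ S)
    (hne : ∃ w ∈ S, w ≠ 0) :
    ∃ u ∈ S, b u u = 1 ∧ ∀ v ∈ S, a u u * b v v ≤ a v v := by
  obtain ⟨w, hwS, hw0⟩ := hne
  have hscale : ∀ v, v ≠ 0 → b ((Real.sqrt (b v v))⁻¹ • v) ((Real.sqrt (b v v))⁻¹ • v) = 1 ∧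
      a ((Real.sqrt (b v v))⁻¹ • v) ((Real.sqrt (b v v))⁻¹ • v) = a v v / b v v := by
    intro v hv
    have hb := h.pos_b v hv
    have hs : Real.sqrt (b v v) * Real.sqrt (b v v) = b v v := Real.mul_self_sqrt hb.le
    have hs0 : Real.sqrt (b v v) ≠ 0 := (Real.sqrt_pos.2 hb).ne'
    simp only [map_smul, LinearMap.smul_apply, smul_eq_mul]
    constructor
    · rw [← mul_assoc, ← mul_inv, hs, inv_mul_cancel₀ hb.ne']
    · rw [← mul_assoc, ← mul_inv, hs, div_eq_inv_mul]
  set T : Set ℝ := {r | ∃ v ∈ S, b v v = 1 ∧ a v v = r} with hT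
  have hTne : T.Nonempty := ⟨_, _, S.smul_mem _ hwS, (hscale w hw0).1, rfl⟩
  have hTbdd : BddBelow T := by
    refine ⟨1 - C, ?_⟩
    rintro r ⟨v, -, hv, rfl⟩
    have := h.le_add v
    rw [hv] at this
    linarith
  set m := sInf T with hm
  have hlow : ∀ v ∈ S, m * b v v ≤ a v v := by
    intro v hv
    by_cases hv0 : v = 0
    · simp [hv0]
    · obtain ⟨h1, h2⟩ := hscale v hv0
      have : m ≤ a v v / b v v := csInf_le hTbdd ⟨_, S.smul_mem _ hv, h1, h2⟩
      rwa [le_div_iff₀ (h.pos_b v hv0)] at this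
  have hex : ∀ n : ℕ, ∃ v ∈ S, b v v = 1 ∧ a v v < m + 1 / ((n : ℝ) + 1) := by
    intro n
    obtain ⟨r, ⟨v, hv, hb, rfl⟩, hr⟩ := exists_lt_of_csInf_lt hTne
      (show sInf T < m + 1 / ((n : ℝ) + 1) by
        have : (0 : ℝ) < 1 / ((n : ℝ) + 1) := by positivity
        linarith)
    exact ⟨v, hv, hb, hr⟩
  choose u huS hub hua using hex
  have hutend : Tendsto (fun n => a (u n) (u n)) atTop (𝓝 m) := by
    refine tendsto_of_tendsto_of_tendsto_of_le_of_le tendsto_const_nhds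
      (by simpa using tendsto_one_div_add_atTop_nhds_zero_nat.const_add m) (fun n => ?_)
      (fun n => (hua n).le)
    have := hlow (u n) (huS n)
    rwa [hub, mul_one] at this
  obtain ⟨φ, hφ, hφb⟩ := h.compact u (m + 1 + C) (fun n => by
    have h1 := hua n
    have h2 : 1 / ((n : ℝ) + 1) ≤ 1 := by
      rw [div_le_one (by positivity)]
      have : (0 : ℝ) ≤ n := n.cast_nonneg
      linarith
    rw [hub]
    linarith)
  -- Parallelogram identity: for unit `u, v` in `S`, `a(u+v) ≥ m b(u+v) = m (4 - b(u-v))`, so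
  -- `a(u-v) + C b(u-v) ≤ 2 (a(u) - m) + 2 (a(v) - m) + (m + C) b(u-v)`. Thus a minimizing sequence
  -- that is Cauchy for `b` is Cauchy for the energy.
  have hcau : Tendsto (fun p : ℕ × ℕ =>
      a (u (φ p.1) - u (φ p.2)) (u (φ p.1) - u (φ p.2))
      + C * b (u (φ p.1) - u (φ p.2)) (u (φ p.1) - u (φ p.2))) atTop (𝓝 0) := by
    have hsub : Tendsto (fun n => a (u (φ n)) (u (φ n))) atTop (𝓝 m) :=
      hutend.comp hφ.tendsto_atTop
    have t1 : Tendsto (fun p : ℕ × ℕ => a (u (φ p.1)) (u (φ p.1))) atTop (𝓝 m) := by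
      rw [← prod_atTop_atTop_eq]
      exact hsub.comp tendsto_fst
    have t2 : Tendsto (fun p : ℕ × ℕ => a (u (φ p.2)) (u (φ p.2))) atTop (𝓝 m) := by
      rw [← prod_atTop_atTop_eq]
      exact hsub.comp tendsto_snd
    have t3 := (((t1.sub_const m).const_mul 2).add ((t2.sub_const m).const_mul 2)).add
      (hφb.const_mul (m + C))
    have t4 : (2 : ℝ) * (m - m) + 2 * (m - m) + (m + C) * 0 = 0 := by ring
    rw [t4] at t3
    refine tendsto_of_tendsto_of_tendsto_of_le_of_le tendsto_const_nhds t3 (fun p => ?_)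
      (fun p => ?_)
    · exact (h.nonneg_b _).trans (h.le_add _)
    · have h1 := hlow (u (φ p.1) + u (φ p.2)) (S.add_mem (huS _) (huS _))
      have h2 := hub (φ p.1)
      have h3 := hub (φ p.2)
      simp only [map_add, map_sub, LinearMap.add_apply, LinearMap.sub_apply] at h1 ⊢
      rw [h.symm_b (u (φ p.2)) (u (φ p.1)), h.symm_a (u (φ p.2)) (u (φ p.1)), h2, h3] at *
      nlinarith
  obtain ⟨v, hv⟩ := h.complete (fun n => u (φ n)) hcau
  have hvb : Tendsto (fun n => b (u (φ n) - v) (u (φ n) - v)) atTop (𝓝 0) :=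
    tendsto_of_tendsto_of_tendsto_of_le_of_le tendsto_const_nhds hv
      (fun n => h.nonneg_b _) (fun n => h.le_add _)
  have hb1 : b v v = 1 := by
    refine tendsto_nhds_unique (tendsto_form_self h.symm_b h.nonneg_b hvb) ?_
    simp [hub]
  have ha1 : a v v = m := by
    have := tendsto_form_self (c := a + C • b) (u := fun n => u (φ n)) (v := v)
      (by intro x y; simp [h.symm_a x y, h.symm_b x y])
      (by intro x; simpa using (h.nonneg_b x).trans (h.le_add x))
      (by simpa using hv)
    have h2 : Tendsto (fun n => (a + C • b) (u (φ n)) (u (φ n))) atTop (𝓝 (m + C)) := by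
      simpa [hub] using (hutend.comp hφ.tendsto_atTop).add_const C
    have h3 := tendsto_nhds_unique this h2
    simp [hb1] at h3
    exact h3
  refine ⟨v, hS _ v (fun n => huS (φ n)) hvb, hb1, ?_⟩
  rw [ha1]
  exact hlow

/-- A minimizer satisfies the Euler–Lagrange equation on the subspace. -/
theorem eulerLagrange (h : IsCompactForm a b C) {S : Submodule ℝ E} {u : E} (hu : u ∈ S)
    (hb : b u u = 1) (hmin : ∀ v ∈ S, a u u * b v v ≤ a v v) {v : E} (hv : v ∈ S) :
    a u v = a u u * b u v := by
  by_contra hne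
  set d := a u v - a u u * b u v with hd
  have hd0 : d ≠ 0 := sub_ne_zero.2 hne
  have hquad : ∀ t : ℝ, 0 ≤ 2 * t * d + t ^ 2 * (a v v - a u u * b v v) := by
    intro t
    have := hmin (u + t • v) (S.add_mem hu (S.smul_mem t hv))
    simp only [map_add, map_smul, LinearMap.add_apply, LinearMap.smul_apply, smul_eq_mul] at this
    rw [h.symm_a v u, h.symm_b v u, hb] at this
    rw [hd]
    nlinarith
  set K := a v v - a u u * b v v with hK
  have hKp : 0 ≤ K := by linarith [hmin v hv]
  -- The optimal `t` would be `-d / K`; using `K + 1` avoids division by zero and still makes the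
  -- quadratic negative.
  have := hquad (-d / (K + 1))
  have h2 : 2 * (-d / (K + 1)) * d + (-d / (K + 1)) ^ 2 * K
      = - (d ^ 2 * (K + 2) / (K + 1) ^ 2) := by
    field_simp
    ring
  rw [h2] at this
  have h3 : 0 < d ^ 2 * (K + 2) / (K + 1) ^ 2 := by positivity
  linarith

/-- The first `n` eigenpairs, obtained by successive minimization. -/
theorem exists_eigenpairs (h : IsCompactForm a b C) (hinf : ¬ Module.Finite ℝ E) (n : ℕ) :
    ∃ (e : ℕ → E) (m : ℕ → ℝ),
      (∀ i < n, ∀ j < n, b (e i) (e j) = if i = j then 1 else 0) ∧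
      (∀ i < n, ∀ v, a (e i) v = m i * b (e i) v) ∧
      (∀ j < n, ∀ v, (∀ i < j, b (e i) v = 0) → m j * b v v ≤ a v v) := by
  induction n with
  | zero => exact ⟨0, 0, by simp, by simp, by simp⟩
  | succ n ih =>
    obtain ⟨e, m, hon, heig, hmin⟩ := ih
    -- The kernel of `L` is the orthogonal complement of the eigenvectors already found; it is
    -- nonzero because an injective `L` would make `E` finite-dimensional.
    let L : E →ₗ[ℝ] (Fin n → ℝ) := LinearMap.pi fun i => b (e i)
    have hmem : ∀ v, v ∈ LinearMap.ker L ↔ ∀ i < n, b (e i) v = 0 := by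
      intro v
      rw [LinearMap.mem_ker]
      constructor
      · intro hv i hi
        exact congrFun hv ⟨i, hi⟩
      · intro hv
        ext i
        exact hv i i.2
    obtain ⟨u, huS, hub, humin⟩ := h.exists_minimizer (LinearMap.ker L)
      (by
        intro u v hu hlim
        rw [hmem]
        intro i hi
        have := tendsto_form_right h.symm_b h.nonneg_b hlim (e i)
        refine tendsto_nhds_unique this ?_
        simp [fun n => (hmem _).1 (hu n) i hi])
      (by
        by_contra hcon
        push Not at hcon
        refine hinf (Module.Finite.of_injective L ?_)
        rw [← LinearMap.ker_eq_bot, eq_bot_iff]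
        intro x hx
        exact hcon x hx)
    have huo := (hmem u).1 huS
    have heigu : ∀ v, a u v = a u u * b u v := by
      intro v
      -- The Euler–Lagrange equation holds only on the complement. Projecting `v` there extends it
      -- to all of `E`, since both forms vanish between `u` and the earlier eigenvectors.
      let w := v - ∑ i ∈ Finset.range n, b (e i) v • e i
      have hw : w ∈ LinearMap.ker L := by
        rw [hmem]
        intro i hi
        simp only [w, map_sub, map_sum, map_smul, smul_eq_mul]
        rw [Finset.sum_eq_single i]
        · rw [hon i hi i hi]; simp
        · intro j hj hji
          rw [hon i hi j (Finset.mem_range.1 hj), if_neg (Ne.symm hji), mul_zero]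
        · intro hni
          exact absurd (Finset.mem_range.2 hi) hni
      have h1 := h.eulerLagrange huS hub humin hw
      simp only [w, map_sub, map_sum, map_smul, smul_eq_mul] at h1
      rw [Finset.sum_eq_zero, Finset.sum_eq_zero, sub_zero, sub_zero] at h1
      · exact h1
      · intro i hi
        rw [h.symm_b u, huo i (Finset.mem_range.1 hi), mul_zero]
      · intro i hi
        rw [h.symm_a u, heig i (Finset.mem_range.1 hi), huo i (Finset.mem_range.1 hi)]
        simp
    have hlt : ∀ i, i < n → Function.update e n u i = e i := fun i hi =>
      Function.update_of_ne hi.ne _ _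
    have hltm : ∀ i, i < n → Function.update m n (a u u) i = m i := fun i hi =>
      Function.update_of_ne hi.ne _ _
    refine ⟨Function.update e n u, Function.update m n (a u u), ?_, ?_, ?_⟩
    · intro i hi j hj
      rcases Nat.lt_succ_iff_lt_or_eq.1 hi with hi | rfl <;>
        rcases Nat.lt_succ_iff_lt_or_eq.1 hj with hj | rfl
      · rw [hlt i hi, hlt j hj, hon i hi j hj]
      · rw [hlt i hi, Function.update_self, huo i hi, if_neg hi.ne]
      · rw [hlt j hj, Function.update_self, h.symm_b, huo j hj, if_neg hj.ne']
      · simp [hub]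
    · intro i hi v
      rcases Nat.lt_succ_iff_lt_or_eq.1 hi with hi | rfl
      · rw [hlt i hi, hltm i hi, heig i hi]
      · rw [Function.update_self, Function.update_self]
        exact heigu v
    · intro j hj v hv
      rcases Nat.lt_succ_iff_lt_or_eq.1 hj with hj | rfl
      · rw [hltm j hj]
        exact hmin j hj v fun i hi => by
          have := hv i hi
          rwa [hlt i (hi.trans hj)] at this
      · rw [Function.update_self]
        refine humin v ((hmem v).2 fun i hi => ?_)
        have := hv i hi
        rwa [hlt i hi] at this

/-- The Ky Fan inequality: the sum of the lowest eigenvalues is at most the sum of the energies of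
an orthonormal family. -/
theorem sum_eigenvalues_le (h : IsCompactForm a b C) {n : ℕ} {e : ℕ → E} {m : ℕ → ℝ}
    (hon : ∀ i < n + 1, ∀ j < n + 1, b (e i) (e j) = if i = j then 1 else 0)
    (heig : ∀ i < n + 1, ∀ v, a (e i) v = m i * b (e i) v)
    (hmin : ∀ j < n + 1, ∀ v, (∀ i < j, b (e i) v = 0) → m j * b v v ≤ a v v)
    {ψ : ℕ → E} (hψ : ∀ i j, b (ψ i) (ψ j) = if i = j then 1 else 0) :
    ∑ k ∈ Finset.range (n + 1), m k ≤ ∑ k ∈ Finset.range (n + 1), a (ψ k) (ψ k) := by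
  have hmle : ∀ j < n + 1, m j ≤ m n := by
    intro j hj
    have h1 := hmin j hj (e n) fun i hi => by
      rw [hon i (hi.trans hj) n (Nat.lt_succ_self n), if_neg (by omega)]
    rw [heig n (Nat.lt_succ_self n), hon n (Nat.lt_succ_self n) n (Nat.lt_succ_self n)] at h1
    simpa using h1
  -- With `w` the projection of `v` onto the span of `e 0, …, e n`, the energy splits as `a w w + a
  -- (v - w) (v - w)`, and minimality of `m n` bounds the second term below by `m n * (1 - b w w)`.
  have hray : ∀ v, b v v = 1 →
      m n - ∑ j ∈ Finset.range (n + 1), (m n - m j) * b (e j) v ^ 2 ≤ a v v := by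
    intro v hv
    set w := ∑ j ∈ Finset.range (n + 1), b (e j) v • e j with hw
    have hbw : ∀ i < n + 1, b (e i) w = b (e i) v := by
      intro i hi
      simp only [hw, map_sum, map_smul, smul_eq_mul]
      rw [Finset.sum_eq_single i]
      · rw [hon i hi i hi]; simp
      · intro j hj hji
        rw [hon i hi j (Finset.mem_range.1 hj), if_neg (Ne.symm hji), mul_zero]
      · intro hni
        exact absurd (Finset.mem_range.2 hi) hni
    have hwx : ∀ x, b w x = ∑ j ∈ Finset.range (n + 1), b (e j) v * b (e j) x := by
      intro x
      simp [hw, LinearMap.sum_apply]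
    have hax : ∀ x, a w x = ∑ j ∈ Finset.range (n + 1), m j * (b (e j) v * b (e j) x) := by
      intro x
      simp only [hw, map_sum, map_smul, LinearMap.sum_apply, LinearMap.smul_apply, smul_eq_mul]
      refine Finset.sum_congr rfl fun j hj => ?_
      rw [heig j (Finset.mem_range.1 hj)]
      ring
    have hbwv : b w v = ∑ j ∈ Finset.range (n + 1), b (e j) v ^ 2 := by
      rw [hwx]; exact Finset.sum_congr rfl fun j _ => (sq _).symm
    have hbww : b w w = ∑ j ∈ Finset.range (n + 1), b (e j) v ^ 2 := by
      rw [hwx]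
      refine Finset.sum_congr rfl fun j hj => ?_
      rw [hbw j (Finset.mem_range.1 hj), sq]
    have hawv : a w v = ∑ j ∈ Finset.range (n + 1), m j * b (e j) v ^ 2 := by
      rw [hax]; exact Finset.sum_congr rfl fun j _ => by rw [sq]
    have haww : a w w = ∑ j ∈ Finset.range (n + 1), m j * b (e j) v ^ 2 := by
      rw [hax]
      refine Finset.sum_congr rfl fun j hj => ?_
      rw [hbw j (Finset.mem_range.1 hj), sq]
    have h1 := hmin n (Nat.lt_succ_self n) (v - w) fun i hi => by
      rw [map_sub, hbw i (by omega), sub_self]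
    simp only [map_sub, LinearMap.sub_apply] at h1
    rw [h.symm_b v w, h.symm_a v w, hbwv, hbww, hawv, haww, hv] at h1
    simp only [sub_mul, Finset.sum_sub_distrib, ← Finset.mul_sum]
    linarith
  have hbessel : ∀ j < n + 1, ∑ k ∈ Finset.range (n + 1), b (e j) (ψ k) ^ 2 ≤ 1 := by
    intro j hj
    set w := ∑ k ∈ Finset.range (n + 1), b (e j) (ψ k) • ψ k with hw
    have hbwe : b (e j) w = ∑ k ∈ Finset.range (n + 1), b (e j) (ψ k) ^ 2 := by
      simp only [hw, map_sum, map_smul, smul_eq_mul, sq]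
    have hbww : b w w = ∑ k ∈ Finset.range (n + 1), b (e j) (ψ k) ^ 2 := by
      have : ∀ k ∈ Finset.range (n + 1), b (ψ k) w = b (e j) (ψ k) := by
        intro k hk
        simp only [hw, map_sum, map_smul, smul_eq_mul, hψ]
        simp only [mul_ite, mul_one, mul_zero, Finset.sum_ite_eq, hk, if_true]
      have hwx : ∀ x, b w x = ∑ k ∈ Finset.range (n + 1), b (e j) (ψ k) * b (ψ k) x := by
        intro x
        simp [hw, LinearMap.sum_apply]
      rw [hwx]
      refine Finset.sum_congr rfl fun k hk => ?_
      rw [this k hk, sq]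
    have h1 := h.nonneg_b (e j - w)
    simp only [map_sub, LinearMap.sub_apply] at h1
    rw [h.symm_b w (e j), hbwe, hbww, hon j hj j hj] at h1
    simp at h1
    linarith
  -- The coefficients `m n - m k` are nonnegative, so Bessel's inequality for the family `ψ` applies
  -- termwise before the double sum is exchanged.
  calc ∑ k ∈ Finset.range (n + 1), m k
      = ∑ k ∈ Finset.range (n + 1), (m n - (m n - m k) * 1) :=
        Finset.sum_congr rfl fun k _ => by ring
    _ ≤ ∑ k ∈ Finset.range (n + 1),
          (m n - (m n - m k) * ∑ l ∈ Finset.range (n + 1), b (e k) (ψ l) ^ 2) := by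
        refine Finset.sum_le_sum fun k hk => ?_
        have hk := Finset.mem_range.1 hk
        have := mul_le_mul_of_nonneg_left (hbessel k hk) (sub_nonneg.2 (hmle k hk))
        linarith
    _ = ∑ l ∈ Finset.range (n + 1),
          (m n - ∑ j ∈ Finset.range (n + 1), (m n - m j) * b (e j) (ψ l) ^ 2) := by
        rw [Finset.sum_sub_distrib, Finset.sum_sub_distrib, Finset.sum_comm]
        simp only [Finset.mul_sum]
    _ ≤ _ := Finset.sum_le_sum fun l _ => hray (ψ l) (by simp [hψ])

end IsCompactForm

end Variational

/-! ### Comparison of eigenvalue lists by counting multiplicities -/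

/-- If `lam` is monotone and lists every `m i` (`i ≤ k`) with at least its multiplicity among
them, then `lam k ≤ m k`, provided `m` is monotone up to `k`. -/
theorem le_of_encard_le {lam m : ℕ → ℝ} (hlam : Monotone lam) {k : ℕ}
    (hm : ∀ i ≤ k, m i ≤ m k)
    (hcard : ∀ μ, {i | i ≤ k ∧ m i = μ}.encard ≤ {i | lam i = μ}.encard) :
    lam k ≤ m k := by
  by_contra! hlt
  -- If `m k < lam k`, every index at which `lam` takes one of the values `m 0, …, m k` is below
  -- `k`. Those `k` indices would have to accommodate `k + 1` entries.
  have hfin : ∀ i ≤ k, {j | lam j = m i} ⊆ (Finset.range k : Set ℕ) := by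
    intro i hi j hj
    rw [Finset.coe_range, Set.mem_Iio]
    by_contra! hkj
    have h1 := hlam hkj
    rw [hj] at h1
    exact absurd (hm i hi) (not_le.2 (hlt.trans_le h1))
  have h1 : ∀ μ ∈ (Finset.range (k + 1)).image m,
      ((Finset.range (k + 1)).filter fun i => m i = μ).card
        ≤ ((Finset.range k).filter fun i => lam i = μ).card := by
    intro μ hμ
    obtain ⟨i, hi, rfl⟩ := Finset.mem_image.1 hμ
    have hi : i ≤ k := Nat.lt_succ_iff.1 (Finset.mem_range.1 hi)
    have := hcard (m i)
    have e1 : {j | j ≤ k ∧ m j = m i} =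
        (((Finset.range (k + 1)).filter fun j => m j = m i : Finset ℕ) : Set ℕ) := by
      ext j; simp
    have e2 : {j | lam j = m i} =
        (((Finset.range k).filter fun j => lam j = m i : Finset ℕ) : Set ℕ) := by
      ext j
      constructor
      · intro hj
        have := hfin i hi hj
        simp at this ⊢
        exact ⟨this, hj⟩
      · intro hj
        simp at hj
        exact hj.2
    rw [e1, e2, Set.encard_coe_eq_coe_finsetCard, Set.encard_coe_eq_coe_finsetCard] at this
    exact_mod_cast this
  have h2 : (Finset.range (k + 1)).card =
      ∑ μ ∈ (Finset.range (k + 1)).image m,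
        ((Finset.range (k + 1)).filter fun i => m i = μ).card :=
    Finset.card_eq_sum_card_fiberwise fun i hi => Finset.mem_image_of_mem m hi
  have h3 : ∑ μ ∈ (Finset.range (k + 1)).image m,
        ((Finset.range k).filter fun i => lam i = μ).card ≤ (Finset.range k).card := by
    rw [← Finset.card_biUnion]
    · exact Finset.card_le_card (by
        intro i hi
        simp only [Finset.mem_biUnion, Finset.mem_filter] at hi
        exact hi.choose_spec.2.1)
    · intro x _ y _ hxy
      rw [Function.onFun, Finset.disjoint_left]
      intro i hi hi'
      exact hxy ((Finset.mem_filter.1 hi).2.symm.trans (Finset.mem_filter.1 hi').2)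
  have h4 := Finset.sum_le_sum h1
  rw [← h2] at h4
  have := h4.trans h3
  simp at this

/-! ### Convergence and elementary estimates in `L²` -/

section SquareIntegrable

theorem integrable_fun_mul {f g : ℝ → ℝ} (hf : MemLp f 2 volume) (hg : MemLp g 2 volume) :
    Integrable (fun x => f x * g x) volume :=
  hf.integrable_mul hg

theorem norm_toLp_sq {f : ℝ → ℝ} (hf : MemLp f 2 volume) :
    ‖hf.toLp f‖ ^ 2 = ∫ x, f x ^ 2 := by
  rw [← real_inner_self_eq_norm_sq, L2.inner_def]
  refine integral_congr_ae ?_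
  filter_upwards [hf.coeFn_toLp] with x hx
  rw [hx]
  simp [sq]

theorem dist_toLp_eq {f g : ℝ → ℝ} (hf : MemLp f 2 volume) (hg : MemLp g 2 volume) :
    dist (hf.toLp f) (hg.toLp g) = Real.sqrt (∫ x, (f x - g x) ^ 2) := by
  rw [dist_eq_norm, ← MemLp.toLp_sub]
  refine (Real.sqrt_eq_iff_eq_sq (integral_nonneg fun x => sq_nonneg _) (norm_nonneg _)).2 ?_ |>.symm
  rw [norm_toLp_sq]
  rfl

/-- `L²(ℝ)` is complete. -/
theorem exists_tendsto_integral_sq {f : ℕ → ℝ → ℝ} (hf : ∀ n, MemLp (f n) 2 volume)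
    (hc : Tendsto (fun p : ℕ × ℕ => ∫ x, (f p.1 x - f p.2 x) ^ 2) atTop (𝓝 0)) :
    ∃ g : ℝ → ℝ, MemLp g 2 volume ∧ Tendsto (fun n => ∫ x, (f n x - g x) ^ 2) atTop (𝓝 0) ∧
      ∃ ns : ℕ → ℕ, StrictMono ns ∧ ∀ᵐ x, Tendsto (fun i => f (ns i) x) atTop (𝓝 (g x)) := by
  have hcau : CauchySeq fun n => (hf n).toLp (f n) := by
    rw [cauchySeq_iff_tendsto_dist_atTop_0]
    simp only [dist_toLp_eq]
    simpa using hc.sqrt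
  obtain ⟨G, hG⟩ := cauchySeq_tendsto_of_complete hcau
  have hGm : MemLp (G : ℝ → ℝ) 2 volume := Lp.memLp G
  refine ⟨G, hGm, ?_, ?_⟩
  · have h1 := tendsto_iff_dist_tendsto_zero.1 hG
    have h2 := h1.pow 2
    rw [zero_pow two_ne_zero] at h2
    refine h2.congr fun n => ?_
    conv_lhs => rw [← Lp.toLp_coeFn G hGm]
    rw [dist_toLp_eq, Real.sq_sqrt (integral_nonneg fun x => sq_nonneg _)]
  · obtain ⟨ns, hns, hlim⟩ := (tendstoInMeasure_of_tendsto_Lp hG).exists_seq_tendsto_ae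
    refine ⟨ns, hns, ?_⟩
    have hae : ∀ᵐ x, ∀ n, (hf n).toLp (f n) x = f n x := ae_all_iff.2 fun n => (hf n).coeFn_toLp
    filter_upwards [hlim, hae] with x hx hx'
    simpa [hx'] using hx

/-- The `L²` limit agrees almost everywhere with the pointwise one, because a subsequence converges
to it almost everywhere. -/
theorem tendsto_integral_sq_of_tendsto {f : ℕ → ℝ → ℝ} {g : ℝ → ℝ}
    (hf : ∀ n, MemLp (f n) 2 volume)
    (hc : Tendsto (fun p : ℕ × ℕ => ∫ x, (f p.1 x - f p.2 x) ^ 2) atTop (𝓝 0))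
    (hg : ∀ x, Tendsto (fun n => f n x) atTop (𝓝 (g x))) :
    MemLp g 2 volume ∧ Tendsto (fun n => ∫ x, (f n x - g x) ^ 2) atTop (𝓝 0) := by
  obtain ⟨G, hG, hlim, ns, hns, hae⟩ := exists_tendsto_integral_sq hf hc
  have heq : G =ᵐ[volume] g := by
    filter_upwards [hae] with x hx
    exact tendsto_nhds_unique hx ((hg x).comp hns.tendsto_atTop)
  refine ⟨(memLp_congr_ae heq).1 hG, hlim.congr fun n => integral_congr_ae ?_⟩
  filter_upwards [heq] with x hx
  rw [hx]

/-- Integrated form of `|f| ≤ t f² + 1/t`. The free parameter does the work of Cauchy–Schwarz: small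
`t` gives equicontinuity, large `t` gives convergence of primitives. -/
theorem abs_intervalIntegral_le {f : ℝ → ℝ} (hf : MemLp f 2 volume) (x y : ℝ) {t : ℝ}
    (ht : 0 < t) : |∫ z in x..y, f z| ≤ t * (∫ z, f z ^ 2) + |y - x| / t := by
  have hsq := hf.integrable_sq
  have hint : ∀ a b : ℝ, IntervalIntegrable (fun z => t * f z ^ 2 + 1 / t) volume a b := fun a b =>
    ((hsq.const_mul t).intervalIntegrable).add intervalIntegrable_const
  have hpt : ∀ z, ‖f z‖ ≤ t * f z ^ 2 + 1 / t := by
    intro z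
    rw [Real.norm_eq_abs]
    have h1 : 0 ≤ (t * |f z| - 1) ^ 2 := sq_nonneg _
    have h2 : t * f z ^ 2 + 1 / t - |f z| = ((t * |f z| - 1) ^ 2 + t * |f z|) / t := by
      rw [← sq_abs (f z)]
      field_simp
      ring
    have h3 : 0 ≤ ((t * |f z| - 1) ^ 2 + t * |f z|) / t := by positivity
    linarith
  have key : ∀ a b : ℝ, a ≤ b → |∫ z in a..b, f z| ≤ t * (∫ z, f z ^ 2) + |b - a| / t := by
    intro a b hab
    have h1 := intervalIntegral.norm_integral_le_of_norm_le (μ := volume) (f := f) hab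
      (Eventually.of_forall fun z _ => hpt z) (hint a b)
    rw [intervalIntegral.integral_add (hsq.const_mul t).intervalIntegrable
      intervalIntegrable_const, intervalIntegral.integral_const_mul,
      intervalIntegral.integral_const, smul_eq_mul, Real.norm_eq_abs,
      intervalIntegral.integral_of_le (f := fun z => f z ^ 2) hab] at h1
    have h2 : ∫ z in Set.Ioc a b, f z ^ 2 ≤ ∫ z, f z ^ 2 :=
      setIntegral_le_integral hsq (Eventually.of_forall fun z => sq_nonneg _)
    rw [abs_of_nonneg (sub_nonneg.2 hab), div_eq_mul_one_div]
    have := mul_le_mul_of_nonneg_left h2 ht.le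
    linarith
  rcases le_total x y with h | h
  · exact key x y h
  · rw [intervalIntegral.integral_symm, abs_neg, abs_sub_comm]
    exact key y x h

end SquareIntegrable

/-! ### Pointwise control of functions in the form domain -/

section Sobolev

variable {V u v : ℝ → ℝ}

namespace InFormDomain

theorem continuous (hu : InFormDomain V u) : Continuous u := by
  rw [continuous_iff_continuousAt]
  intro x
  refine (hu.absolutelyContinuous (x - 1) (x + 1)).continuousOn.continuousAt ?_
  rw [Set.uIcc_of_le (by linarith)]
  exact Icc_mem_nhds (by linarith) (by linarith)

theorem sub_eq_integral_deriv (hu : InFormDomain V u) (x y : ℝ) :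
    u y - u x = ∫ z in x..y, deriv u z :=
  (hu.absolutelyContinuous x y).integral_deriv_eq_sub.symm

/-- Integrating `(u²)' = 2 u u'` from `x` to `y` compares `u x ^ 2` with `u y ^ 2`; averaging over
`y` in the unit interval `(x, x + 1]` replaces `u y ^ 2` by the `L²` norm. -/
theorem sq_le (hu : InFormDomain V u) (x : ℝ) :
    u x ^ 2 ≤ 2 * ((∫ z, u z ^ 2) + ∫ z, deriv u z ^ 2) := by
  have i1 := hu.memLp.integrable_sq
  have i2 := hu.memLp_deriv.integrable_sq
  have hy : ∀ y, x ≤ y → u x ^ 2 ≤ u y ^ 2 + ((∫ z, u z ^ 2) + ∫ z, deriv u z ^ 2) := by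
    intro y hxy
    have hac := hu.absolutelyContinuous x y
    have h1 := hac.integral_deriv_mul_eq_sub hac
    have h2 := intervalIntegral.norm_integral_le_of_norm_le (μ := volume)
      (f := fun z => deriv u z * u z + u z * deriv u z)
      (g := fun z => u z ^ 2 + deriv u z ^ 2) hxy
      (Eventually.of_forall fun z _ => by
        rw [Real.norm_eq_abs, abs_le]
        constructor <;> nlinarith [sq_nonneg (u z + deriv u z), sq_nonneg (u z - deriv u z)])
      (i1.add i2).intervalIntegrable
    rw [h1, Real.norm_eq_abs, intervalIntegral.integral_of_le hxy] at h2
    have h3 : ∫ z in Set.Ioc x y, (u z ^ 2 + deriv u z ^ 2) ≤ ∫ z, (u z ^ 2 + deriv u z ^ 2) :=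
      setIntegral_le_integral (i1.add i2) (Eventually.of_forall fun z => by positivity)
    rw [integral_add i1 i2] at h3
    have h4 := neg_abs_le (u y * u y - u x * u x)
    nlinarith
  have h5 : ∫ _ in Set.Ioc x (x + 1), u x ^ 2 ≤
      ∫ y in Set.Ioc x (x + 1), (u y ^ 2 + ((∫ z, u z ^ 2) + ∫ z, deriv u z ^ 2)) := by
    refine setIntegral_mono_on (integrableOn_const (by simp))
      (i1.integrableOn.add (integrableOn_const (by simp))) measurableSet_Ioc fun y hy' => ?_
    exact hy y hy'.1.le
  rw [integral_add i1.integrableOn (integrableOn_const (by simp))] at h5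
  have h6 : ∫ z in Set.Ioc x (x + 1), u z ^ 2 ≤ ∫ z, u z ^ 2 :=
    setIntegral_le_integral i1 (Eventually.of_forall fun z => sq_nonneg _)
  have h7 : 0 ≤ ∫ z, deriv u z ^ 2 := integral_nonneg fun z => sq_nonneg _
  simp at h5
  linarith

end InFormDomain

end Sobolev

/-! ### Confining potentials and their form domain -/

/-- `V` is measurable and `x² ≤ V x + C` almost everywhere. -/
structure IsConfining (V : ℝ → ℝ) (C : ℝ) : Prop where
  aestronglyMeasurable : AEStronglyMeasurable V volume
  le_add : ∀ᵐ x, x ^ 2 ≤ V x + C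

namespace IsConfining

variable {V : ℝ → ℝ} {C : ℝ} {u v : ℝ → ℝ}

/-- Since `V + C ≥ 0`, the mixed term `(V + C) |u v|` is dominated by `(V + C) (u² + v²)`. This is
what makes the form domain a vector space. -/
theorem integrable_mul_mul (hV : IsConfining V C) (hu : InFormDomain V u)
    (hv : InFormDomain V v) : Integrable (fun x => V x * u x * v x) volume := by
  have i1 : Integrable fun x => V x * u x ^ 2 + C * u x ^ 2 :=
    hu.integrable_potential.add (hu.memLp.integrable_sq.const_mul C)
  have i2 : Integrable fun x => V x * v x ^ 2 + C * v x ^ 2 :=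
    hv.integrable_potential.add (hv.memLp.integrable_sq.const_mul C)
  have i3 : Integrable fun x => (V x + C) * u x * v x := by
    refine (i1.add i2).mono' (((hV.aestronglyMeasurable.add aestronglyMeasurable_const).mul
      hu.memLp.1).mul hv.memLp.1) ?_
    filter_upwards [hV.le_add] with x hx
    have h0 : 0 ≤ V x + C := (sq_nonneg x).trans hx
    simp only [Pi.add_apply]
    rw [Real.norm_eq_abs, abs_le]
    constructor <;>
      nlinarith [mul_nonneg h0 (sq_nonneg (u x + v x)), mul_nonneg h0 (sq_nonneg (u x - v x)),
        mul_nonneg h0 (sq_nonneg (u x)), mul_nonneg h0 (sq_nonneg (v x))]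
  have i4 : Integrable fun x => C * (u x * v x) :=
    (hu.memLp.integrable_mul hv.memLp).const_mul C
  refine (i3.sub i4).congr (Eventually.of_forall fun x => ?_)
  simp only [Pi.sub_apply]
  ring

theorem add_mem (hV : IsConfining V C) (hu : InFormDomain V u) (hv : InFormDomain V v) :
    InFormDomain V (u + v) where
  absolutelyContinuous := fun a b => (hu.absolutelyContinuous a b).add (hv.absolutelyContinuous a b)
  memLp := hu.memLp.add hv.memLp
  memLp_deriv := (memLp_congr_ae (deriv_add_ae hu.absolutelyContinuous
    hv.absolutelyContinuous)).2 (hu.memLp_deriv.add hv.memLp_deriv)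
  integrable_potential := by
    refine ((hu.integrable_potential.add hv.integrable_potential).add
      ((hV.integrable_mul_mul hu hv).const_mul 2)).congr (Eventually.of_forall fun x => ?_)
    simp only [Pi.add_apply]
    ring

end IsConfining

theorem InFormDomain.const_smul {V u : ℝ → ℝ} (hu : InFormDomain V u) (c : ℝ) :
    InFormDomain V (c • u) where
  absolutelyContinuous := fun a b => (hu.absolutelyContinuous a b).const_smul c
  memLp := hu.memLp.const_smul c
  memLp_deriv := by
    rw [deriv_smul_eq]
    exact hu.memLp_deriv.const_smul c
  integrable_potential := by
    refine (hu.integrable_potential.const_mul (c ^ 2)).congr (Eventually.of_forall fun x => ?_)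
    simp only [Pi.smul_apply, smul_eq_mul]
    ring

/-- The form domain of a confining potential, as a real vector space. -/
def formDomain {V : ℝ → ℝ} {C : ℝ} (hV : IsConfining V C) : Submodule ℝ (ℝ → ℝ) where
  carrier := {u | InFormDomain V u}
  zero_mem' := (IsEigenSolution.zero V 0).inFormDomain
  add_mem' := fun hu hv => hV.add_mem hu hv
  smul_mem' := fun c _ hu => hu.const_smul c

/-! ### Inner product and energy as bilinear forms -/

section Forms

variable {V : ℝ → ℝ} {C : ℝ} (hV : IsConfining V C)

theorem deriv_coe_add_ae (u v : formDomain hV) :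
    deriv (u + v : ℝ → ℝ) =ᵐ[volume] deriv (u : ℝ → ℝ) + deriv (v : ℝ → ℝ) :=
  deriv_add_ae u.2.absolutelyContinuous v.2.absolutelyContinuous

theorem deriv_coe_sub_ae (u v : formDomain hV) :
    deriv (u - v : ℝ → ℝ) =ᵐ[volume] fun x => deriv (u : ℝ → ℝ) x - deriv (v : ℝ → ℝ) x := by
  have h := deriv_coe_add_ae hV u (-v)
  have e : deriv ((-v : formDomain hV) : ℝ → ℝ) = - deriv (v : ℝ → ℝ) := by
    rw [Submodule.coe_neg, ← neg_one_smul ℝ, deriv_smul_eq, neg_one_smul]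
  rw [e, Submodule.coe_neg] at h
  rw [sub_eq_add_neg]
  filter_upwards [h] with x hx
  rw [hx]
  simp [sub_eq_add_neg]

/-- The `L²` inner product on the form domain. -/
def innerForm : formDomain hV →ₗ[ℝ] formDomain hV →ₗ[ℝ] ℝ :=
  LinearMap.mk₂ ℝ (fun u v => ∫ x, u.1 x * v.1 x)
    (fun u v w => by
      rw [← integral_add (integrable_fun_mul u.2.memLp w.2.memLp)
        (integrable_fun_mul v.2.memLp w.2.memLp)]
      refine integral_congr_ae (Eventually.of_forall fun x => ?_)
      simp [add_mul])
    (fun c u v => by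
      rw [smul_eq_mul, ← integral_const_mul]
      refine integral_congr_ae (Eventually.of_forall fun x => ?_)
      simp [mul_assoc])
    (fun u v w => by
      rw [← integral_add (integrable_fun_mul u.2.memLp v.2.memLp)
        (integrable_fun_mul u.2.memLp w.2.memLp)]
      refine integral_congr_ae (Eventually.of_forall fun x => ?_)
      simp [mul_add])
    (fun c u v => by
      rw [smul_eq_mul, ← integral_const_mul]
      refine integral_congr_ae (Eventually.of_forall fun x => ?_)
      simp [mul_left_comm])

/-- The kinetic energy form on the form domain. -/
def kineticForm : formDomain hV →ₗ[ℝ] formDomain hV →ₗ[ℝ] ℝ :=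
  LinearMap.mk₂ ℝ (fun u v => ∫ x, deriv u.1 x * deriv v.1 x)
    (fun u v w => by
      rw [← integral_add (integrable_fun_mul u.2.memLp_deriv w.2.memLp_deriv)
        (integrable_fun_mul v.2.memLp_deriv w.2.memLp_deriv)]
      refine integral_congr_ae ?_
      filter_upwards [deriv_coe_add_ae hV u v] with x hx
      rw [Submodule.coe_add, hx]
      simp [add_mul])
    (fun c u v => by
      rw [smul_eq_mul, ← integral_const_mul]
      refine integral_congr_ae (Eventually.of_forall fun x => ?_)
      simp only [Submodule.coe_smul, deriv_smul_eq, Pi.smul_apply, smul_eq_mul, mul_assoc])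
    (fun u v w => by
      rw [← integral_add (integrable_fun_mul u.2.memLp_deriv v.2.memLp_deriv)
        (integrable_fun_mul u.2.memLp_deriv w.2.memLp_deriv)]
      refine integral_congr_ae ?_
      filter_upwards [deriv_coe_add_ae hV v w] with x hx
      rw [Submodule.coe_add, hx]
      simp [mul_add])
    (fun c u v => by
      rw [smul_eq_mul, ← integral_const_mul]
      refine integral_congr_ae (Eventually.of_forall fun x => ?_)
      simp only [Submodule.coe_smul, deriv_smul_eq, Pi.smul_apply, smul_eq_mul, mul_left_comm])

/-- The potential energy form on the form domain. -/
def potentialForm : formDomain hV →ₗ[ℝ] formDomain hV →ₗ[ℝ] ℝ :=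
  LinearMap.mk₂ ℝ (fun u v => ∫ x, V x * u.1 x * v.1 x)
    (fun u v w => by
      rw [← integral_add (hV.integrable_mul_mul u.2 w.2) (hV.integrable_mul_mul v.2 w.2)]
      refine integral_congr_ae (Eventually.of_forall fun x => ?_)
      simp
      ring)
    (fun c u v => by
      rw [smul_eq_mul, ← integral_const_mul]
      refine integral_congr_ae (Eventually.of_forall fun x => ?_)
      simp
      ring)
    (fun u v w => by
      rw [← integral_add (hV.integrable_mul_mul u.2 v.2) (hV.integrable_mul_mul u.2 w.2)]
      refine integral_congr_ae (Eventually.of_forall fun x => ?_)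
      simp
      ring)
    (fun c u v => by
      rw [smul_eq_mul, ← integral_const_mul]
      refine integral_congr_ae (Eventually.of_forall fun x => ?_)
      simp
      ring)

/-- The quadratic form of `-d²/dx² + V`. -/
def energyForm : formDomain hV →ₗ[ℝ] formDomain hV →ₗ[ℝ] ℝ := kineticForm hV + potentialForm hV

theorem innerForm_apply (u v : formDomain hV) : innerForm hV u v = ∫ x, u.1 x * v.1 x := rfl

theorem energyForm_apply (u v : formDomain hV) : energyForm hV u v =
    (∫ x, deriv u.1 x * deriv v.1 x) + ∫ x, V x * u.1 x * v.1 x := rfl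

theorem integrable_shifted (u : formDomain hV) :
    Integrable (fun x => (V x + (C + 1)) * u.1 x ^ 2) volume := by
  refine (u.2.integrable_potential.add (u.2.memLp.integrable_sq.const_mul (C + 1))).congr
    (Eventually.of_forall fun x => ?_)
  simp only [Pi.add_apply]
  ring

theorem energyForm_add_innerForm_self (u : formDomain hV) :
    energyForm hV u u + (C + 1) * innerForm hV u u =
      (∫ x, deriv u.1 x ^ 2) + ∫ x, (V x + (C + 1)) * u.1 x ^ 2 := by
  rw [energyForm_apply, innerForm_apply, add_assoc, ← integral_const_mul,
    ← integral_add (hV.integrable_mul_mul u.2 u.2)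
      ((integrable_fun_mul u.2.memLp u.2.memLp).const_mul (C + 1))]
  congr 1
  · exact integral_congr_ae (Eventually.of_forall fun x => (sq _).symm)
  · refine integral_congr_ae (Eventually.of_forall fun x => ?_)
    dsimp only
    ring

theorem integrable_sq_mul_sq (u : formDomain hV) :
    Integrable (fun x => x ^ 2 * u.1 x ^ 2) volume := by
  refine (integrable_shifted hV u).mono' ?_ ?_
  · exact ((continuous_id.pow 2).mul (u.2.continuous.pow 2)).aestronglyMeasurable
  · filter_upwards [hV.le_add] with x hx
    rw [Real.norm_eq_abs, abs_of_nonneg (by positivity)]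
    nlinarith [mul_le_mul_of_nonneg_right hx (sq_nonneg (u.1 x)), sq_nonneg (u.1 x)]

/-- The shift is `C + 1` rather than `C` so that `V + C + 1 ≥ x² + 1`. The shifted energy then
controls the derivative, the second moment and the `L²` norm at once. -/
theorem integral_parts_le (u : formDomain hV) :
    (∫ x, deriv u.1 x ^ 2) + (∫ x, x ^ 2 * u.1 x ^ 2) + ∫ x, u.1 x ^ 2 ≤
      energyForm hV u u + (C + 1) * innerForm hV u u := by
  rw [energyForm_add_innerForm_self, add_assoc,
    ← integral_add (integrable_sq_mul_sq hV u) u.2.memLp.integrable_sq]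
  refine add_le_add le_rfl (integral_mono_ae
    ((integrable_sq_mul_sq hV u).add u.2.memLp.integrable_sq) (integrable_shifted hV u) ?_)
  filter_upwards [hV.le_add] with x hx
  nlinarith [mul_le_mul_of_nonneg_right hx (sq_nonneg (u.1 x)), sq_nonneg (u.1 x)]

end Forms

/-! ### Compactness of bounded-energy sequences in `L²` -/

section Compactness

variable {V : ℝ → ℝ}

/-- Arzelà–Ascoli in pointwise form: compactness of a product of intervals gives convergence at all
rationals, and the uniform bound on `∫ u'²` gives the equicontinuity that passes from rationals to
reals. -/
theorem exists_subseq_pointwise_cauchy {u : ℕ → ℝ → ℝ} (hu : ∀ n, InFormDomain V (u n)) {M : ℝ}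
    (h0 : ∀ n, ∫ x, u n x ^ 2 ≤ M) (h1 : ∀ n, ∫ x, deriv (u n) x ^ 2 ≤ M) :
    ∃ φ : ℕ → ℕ, StrictMono φ ∧ ∀ x, CauchySeq fun n => u (φ n) x := by
  have hM : 0 ≤ M := (integral_nonneg fun x => sq_nonneg (u 0 x)).trans (h0 0)
  have hbd : ∀ n x, |u n x| ≤ Real.sqrt (4 * M) := fun n x => by
    refine Real.abs_le_sqrt ?_
    linarith [(hu n).sq_le x, h0 n, h1 n]
  have hK : IsCompact (Set.univ.pi fun _ : ℚ => Set.Icc (-Real.sqrt (4 * M)) (Real.sqrt (4 * M))) :=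
    isCompact_univ_pi fun _ => isCompact_Icc
  obtain ⟨w, -, φ, hφ, hw⟩ := hK.tendsto_subseq (x := fun n (r : ℚ) => u n r)
    (fun n r _ => abs_le.1 (hbd n r))
  refine ⟨φ, hφ, fun x => ?_⟩
  rw [Metric.cauchySeq_iff]
  intro ε hε
  -- Chosen so that `t * M ≤ ε / 8`; a rational `r` within `t * (ε / 8)` of `x` then makes the other
  -- term `|r - x| / t` at most `ε / 8`.
  set t : ℝ := ε / (8 * (M + 1)) with ht
  have ht0 : 0 < t := by positivity
  have htM : t * M ≤ ε / 8 := by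
    rw [ht, div_mul_eq_mul_div, div_le_div_iff₀ (by positivity) (by norm_num)]
    nlinarith
  obtain ⟨r, hr1, hr2⟩ := exists_rat_btwn (show x < x + t * (ε / 8) by linarith [mul_pos ht0 hε])
  have hosc : ∀ n, |u n r - u n x| ≤ ε / 4 := by
    intro n
    rw [(hu n).sub_eq_integral_deriv x r]
    refine (abs_intervalIntegral_le (hu n).memLp_deriv x r ht0).trans ?_
    have e1 : |(r : ℝ) - x| / t ≤ ε / 8 := by
      rw [abs_of_pos (by linarith), div_le_iff₀ ht0]
      linarith
    have e2 := mul_le_mul_of_nonneg_left (h1 n) ht0.le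
    linarith
  have hcr : CauchySeq fun n => u (φ n) r := (((tendsto_pi_nhds.1 hw) r)).cauchySeq
  obtain ⟨N, hN⟩ := Metric.cauchySeq_iff.1 hcr (ε / 4) (by linarith)
  refine ⟨N, fun m hm n hn => ?_⟩
  have e1 := abs_le.1 (hosc (φ m))
  have e2 := abs_le.1 (hosc (φ n))
  have e3 := hN m hm n hn
  rw [Real.dist_eq, abs_lt] at e3 ⊢
  constructor <;> linarith [e1.1, e1.2, e2.1, e2.2, e3.1, e3.2]

/-- Dominated convergence handles `[-R, R]`, while the second-moment bound makes the tail at most `4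
M / R²`, uniformly along the sequence. Confinement thus prevents loss of mass at infinity. -/
theorem tendsto_integral_sub_sq {u : ℕ → ℝ → ℝ} (hu : ∀ n, InFormDomain V (u n)) {M : ℝ}
    (h0 : ∀ n, ∫ x, u n x ^ 2 ≤ M) (h1 : ∀ n, ∫ x, deriv (u n) x ^ 2 ≤ M)
    (hi : ∀ n, Integrable (fun x => x ^ 2 * u n x ^ 2) volume)
    (h2 : ∀ n, ∫ x, x ^ 2 * u n x ^ 2 ≤ M) (hc : ∀ x, CauchySeq fun n => u n x) :
    Tendsto (fun p : ℕ × ℕ => ∫ x, (u p.1 x - u p.2 x) ^ 2) atTop (𝓝 0) := by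
  have hM : 0 ≤ M := (integral_nonneg fun x => sq_nonneg (u 0 x)).trans (h0 0)
  have hbd : ∀ n x, u n x ^ 2 ≤ 4 * M := fun n x => by
    linarith [(hu n).sq_le x, h0 n, h1 n]
  have hloc : ∀ R : ℝ, Tendsto (fun p : ℕ × ℕ =>
      ∫ x in Set.Icc (-R) R, (u p.1 x - u p.2 x) ^ 2) atTop (𝓝 0) := by
    intro R
    have := tendsto_integral_filter_of_dominated_convergence
      (μ := volume.restrict (Set.Icc (-R) R)) (l := (atTop : Filter (ℕ × ℕ)))
      (F := fun p x => (u p.1 x - u p.2 x) ^ 2) (f := fun _ => 0) (fun _ => 16 * M)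
      (Eventually.of_forall fun p =>
        (((hu p.1).continuous.sub (hu p.2).continuous).pow 2).aestronglyMeasurable)
      (Eventually.of_forall fun p => Eventually.of_forall fun x => by
        rw [Real.norm_eq_abs, abs_of_nonneg (sq_nonneg _)]
        nlinarith [hbd p.1 x, hbd p.2 x, sq_nonneg (u p.1 x + u p.2 x)])
      (integrableOn_const (by simp))
      (Eventually.of_forall fun x => by
        have h := cauchySeq_iff_tendsto_dist_atTop_0.1 (hc x)
        have h' := h.pow 2
        simpa [Real.dist_eq, sq_abs] using h')
    simpa using this
  have hsplit : ∀ R : ℝ, 0 < R → ∀ p : ℕ × ℕ, ∫ x, (u p.1 x - u p.2 x) ^ 2 ≤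
      (∫ x in Set.Icc (-R) R, (u p.1 x - u p.2 x) ^ 2) + 4 * M / R ^ 2 := by
    intro R hR p
    have hI : Integrable fun x => (u p.1 x - u p.2 x) ^ 2 :=
      ((hu p.1).memLp.sub (hu p.2).memLp).integrable_sq
    rw [← integral_add_compl measurableSet_Icc hI (s := Set.Icc (-R) R)]
    refine add_le_add le_rfl ?_
    have hJ : Integrable fun x => 2 / R ^ 2 * (x ^ 2 * u p.1 x ^ 2 + x ^ 2 * u p.2 x ^ 2) :=
      ((hi p.1).add (hi p.2)).const_mul _
    calc ∫ x in (Set.Icc (-R) R)ᶜ, (u p.1 x - u p.2 x) ^ 2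
        ≤ ∫ x in (Set.Icc (-R) R)ᶜ,
            2 / R ^ 2 * (x ^ 2 * u p.1 x ^ 2 + x ^ 2 * u p.2 x ^ 2) := by
          refine setIntegral_mono_on hI.integrableOn hJ.integrableOn measurableSet_Icc.compl
            fun x hx => ?_
          have hx2 : R ^ 2 ≤ x ^ 2 := by
            rw [Set.mem_compl_iff, Set.mem_Icc, not_and_or, not_le, not_le] at hx
            rcases hx with hx | hx <;> nlinarith
          rw [div_mul_eq_mul_div, le_div_iff₀ (by positivity)]
          have e1 : (u p.1 x - u p.2 x) ^ 2 ≤ 2 * (u p.1 x ^ 2 + u p.2 x ^ 2) := by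
            nlinarith [sq_nonneg (u p.1 x + u p.2 x)]
          have e2 : 0 ≤ u p.1 x ^ 2 + u p.2 x ^ 2 := by positivity
          have e3 := mul_le_mul_of_nonneg_left hx2 e2
          have e4 := mul_le_mul_of_nonneg_right e1 (sq_nonneg R)
          linarith
      _ ≤ ∫ x, 2 / R ^ 2 * (x ^ 2 * u p.1 x ^ 2 + x ^ 2 * u p.2 x ^ 2) :=
          setIntegral_le_integral hJ (Eventually.of_forall fun x => by positivity)
      _ ≤ 4 * M / R ^ 2 := by
          rw [integral_const_mul, integral_add (hi p.1) (hi p.2), div_mul_eq_mul_div]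
          refine div_le_div_of_nonneg_right ?_ (by positivity)
          linarith [h2 p.1, h2 p.2]
  rw [Metric.tendsto_nhds]
  intro ε hε
  obtain ⟨R, hR0, hR⟩ : ∃ R : ℝ, 0 < R ∧ 4 * M / R ^ 2 < ε / 2 := by
    refine ⟨Real.sqrt (8 * M / ε + 1), Real.sqrt_pos.2 (by positivity), ?_⟩
    rw [Real.sq_sqrt (by positivity), div_lt_iff₀ (by positivity)]
    have : ε / 2 * (8 * M / ε + 1) = 4 * M + ε / 2 := by
      field_simp
      ring
    linarith
  filter_upwards [Metric.tendsto_nhds.1 (hloc R) (ε / 2) (by linarith)] with p hp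
  rw [Real.dist_eq, sub_zero, abs_of_nonneg (integral_nonneg fun x => sq_nonneg _)] at hp ⊢
  linarith [hsplit R hR0 p]

end Compactness

/-! ### Completeness of the form domain -/

section Completeness

theorem locallyIntegrable_of_memLp_two {g : ℝ → ℝ} (hg : MemLp g 2 volume) :
    LocallyIntegrable g volume :=
  hg.locallyIntegrable (by norm_num)

/-- An indefinite integral of a locally integrable function is locally absolutely continuous. -/
theorem absolutelyContinuousOnInterval_of_eq_integral {g w : ℝ → ℝ}
    (hg : LocallyIntegrable g volume) (hw : ∀ x, w x - w 0 = ∫ z in (0 : ℝ)..x, g z) (a b : ℝ) :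
    AbsolutelyContinuousOnInterval w a b := by
  -- The interval `[-R, R]` contains `a`, `b` and the base point `0` of the primitive.
  set R := |a| + |b| with hR
  have hI : IntervalIntegrable g volume (-R) R :=
    intervalIntegrable_iff.mpr
      ((hg.integrableOn_isCompact isCompact_uIcc).mono_set Set.uIoc_subset_uIcc)
  have hR0 : 0 ≤ R := by positivity
  have h1 := hI.absolutelyContinuousOnInterval_intervalIntegral (c := 0)
    (by rw [Set.uIcc_of_le (by linarith)]; constructor <;> linarith)
  have h2 : AbsolutelyContinuousOnInterval (fun _ : ℝ => w 0) (-R) R :=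
    LipschitzOnWith.absolutelyContinuousOnInterval (K := 0) (by
      intro x _ y _
      simp)
  have h3 := h1.add h2
  have e : (fun x => ∫ v in (0 : ℝ)..x, g v) + (fun _ : ℝ => w 0) = w := by
    ext x
    simp [← hw x]
  rw [e] at h3
  refine h3.mono ?_
  rw [Set.uIcc_of_le (show -R ≤ R by linarith)]
  refine Set.uIcc_subset_Icc ⟨?_, ?_⟩ ⟨?_, ?_⟩ <;>
    linarith [neg_abs_le a, le_abs_self a, neg_abs_le b, le_abs_self b, abs_nonneg a, abs_nonneg b]

theorem deriv_ae_eq_of_eq_integral {g w : ℝ → ℝ}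
    (hg : LocallyIntegrable g volume) (hw : ∀ x, w x - w 0 = ∫ z in (0 : ℝ)..x, g z) :
    deriv w =ᵐ[volume] g := by
  filter_upwards [LocallyIntegrable.ae_hasDerivAt_integral hg] with x hx
  have h1 := (hx 0).add_const (w 0)
  have e : (fun x => (∫ v in (0 : ℝ)..x, g v) + w 0) = w := by
    ext x
    simp [← hw x]
  rw [e] at h1
  exact h1.deriv

variable {V : ℝ → ℝ} {C : ℝ} (hV : IsConfining V C)

/-- By `sq_le` the sequence converges pointwise to some `w`, and the derivatives converge in `L²` to
some `g`. Then `w` is a primitive of `g`, hence locally absolutely continuous with `w' = g` almost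
everywhere. The potential part is an `L²` statement about `√(V + C + 1) u_n`. -/
theorem exists_limit_energy (u : ℕ → formDomain hV)
    (hc : Tendsto (fun p : ℕ × ℕ => energyForm hV (u p.1 - u p.2) (u p.1 - u p.2)
      + (C + 1) * innerForm hV (u p.1 - u p.2) (u p.1 - u p.2)) atTop (𝓝 0)) :
    ∃ v, Tendsto (fun n => energyForm hV (u n - v) (u n - v)
      + (C + 1) * innerForm hV (u n - v) (u n - v)) atTop (𝓝 0) := by
  have hparts := fun p : ℕ × ℕ => integral_parts_le hV (u p.1 - u p.2)
  have hn0 : ∀ w : ℝ → ℝ, 0 ≤ ∫ x, w x ^ 2 := fun w => integral_nonneg fun x => sq_nonneg _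
  have hn1 : ∀ w : ℝ → ℝ, 0 ≤ ∫ x, x ^ 2 * w x ^ 2 := fun w =>
    integral_nonneg fun x => by positivity
  have hsub : ∀ v w : formDomain hV, ∫ x, deriv (v - w : formDomain hV).1 x ^ 2
      = ∫ x, (deriv v.1 x - deriv w.1 x) ^ 2 := fun v w => by
    refine integral_congr_ae ?_
    filter_upwards [deriv_coe_sub_ae hV v w] with x hx
    rw [Submodule.coe_sub, hx]
  have hL2 : Tendsto (fun p : ℕ × ℕ => ∫ x, ((u p.1).1 x - (u p.2).1 x) ^ 2) atTop (𝓝 0) :=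
    squeeze_zero (fun p => integral_nonneg fun x => sq_nonneg _) (fun p => by
      have := hparts p
      linarith [hn0 (deriv (u p.1 - u p.2).1), hn1 (u p.1 - u p.2).1,
        show ∫ x, (u p.1 - u p.2).1 x ^ 2 = ∫ x, ((u p.1).1 x - (u p.2).1 x) ^ 2 from rfl]) hc
  have hD2 : Tendsto (fun p : ℕ × ℕ => ∫ x, (deriv (u p.1).1 x - deriv (u p.2).1 x) ^ 2)
      atTop (𝓝 0) :=
    squeeze_zero (fun p => integral_nonneg fun x => sq_nonneg _) (fun p => by
      rw [← hsub]
      linarith [hparts p, hn0 (u p.1 - u p.2).1, hn1 (u p.1 - u p.2).1]) hc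
  have hpt : ∀ x, CauchySeq fun n => (u n).1 x := by
    intro x
    rw [cauchySeq_iff_tendsto_dist_atTop_0]
    have h2 : Tendsto (fun p : ℕ × ℕ => 2 * ((∫ x, ((u p.1).1 x - (u p.2).1 x) ^ 2) +
        ∫ x, (deriv (u p.1).1 x - deriv (u p.2).1 x) ^ 2)) atTop (𝓝 0) := by
      simpa using (hL2.add hD2).const_mul 2
    have h3 := h2.sqrt
    rw [Real.sqrt_zero] at h3
    refine squeeze_zero (fun p => dist_nonneg) (fun p => ?_) h3
    rw [Real.dist_eq]
    refine Real.abs_le_sqrt ?_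
    have := (u p.1 - u p.2).2.sq_le x
    rw [hsub] at this
    exact this
  choose w hw using fun x => cauchySeq_tendsto_of_complete (hpt x)
  obtain ⟨g, hg, hglim, -⟩ := exists_tendsto_integral_sq (fun n => (u n).2.memLp_deriv) hD2
  obtain ⟨hwm, -⟩ := tendsto_integral_sq_of_tendsto (fun n => (u n).2.memLp) hL2 hw
  have hloc := locallyIntegrable_of_memLp_two hg
  have hint : ∀ {f : ℝ → ℝ}, MemLp f 2 volume → ∀ x y : ℝ, IntervalIntegrable f volume x y :=
    fun hf x y => intervalIntegrable_iff.mpr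
      (((locallyIntegrable_of_memLp_two hf).integrableOn_isCompact isCompact_uIcc).mono_set
        Set.uIoc_subset_uIcc)
  have hprim : ∀ x, w x - w 0 = ∫ z in (0 : ℝ)..x, g z := by
    intro x
    have t1 : Tendsto (fun n => ∫ z in (0 : ℝ)..x, deriv (u n).1 z) atTop (𝓝 (w x - w 0)) := by
      simp_rw [← fun n => (u n).2.sub_eq_integral_deriv 0 x]
      exact (hw x).sub (hw 0)
    refine tendsto_nhds_unique t1 ?_
    rw [Metric.tendsto_nhds]
    intro ε hε
    -- Large enough that `|x| / t ≤ ε / 2`; with `t` fixed, the remaining term tends to zero.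
    set t : ℝ := 2 * (|x - 0| + 1) / ε with ht
    have ht0 : 0 < t := by positivity
    have h1 : Tendsto (fun n => t * ∫ z, (deriv (u n).1 z - g z) ^ 2) atTop (𝓝 0) := by
      simpa using hglim.const_mul t
    filter_upwards [Metric.tendsto_nhds.1 h1 (ε / 2) (by linarith)] with n hn
    rw [Real.dist_eq, ← intervalIntegral.integral_sub (hint (u n).2.memLp_deriv 0 x)
      (hint hg 0 x)]
    have h2 := abs_intervalIntegral_le ((u n).2.memLp_deriv.sub hg) 0 x ht0
    have h3 : |x - 0| / t ≤ ε / 2 := by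
      rw [ht, div_div_eq_mul_div, div_le_div_iff₀ (by positivity) (by norm_num)]
      nlinarith [abs_nonneg (x - 0)]
    rw [Real.dist_eq, sub_zero] at hn
    have h4 := le_abs_self (t * ∫ z, (deriv (u n).1 z - g z) ^ 2)
    simp only [Pi.sub_apply] at h2
    linarith
  have hder := deriv_ae_eq_of_eq_integral hloc hprim
  have hWm : AEStronglyMeasurable (fun x => Real.sqrt (V x + (C + 1))) volume :=
    Real.continuous_sqrt.comp_aestronglyMeasurable
      (hV.aestronglyMeasurable.add aestronglyMeasurable_const)
  have hWsq : ∀ f : ℝ → ℝ, (fun x => (Real.sqrt (V x + (C + 1)) * f x) ^ 2)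
      =ᵐ[volume] fun x => (V x + (C + 1)) * f x ^ 2 := by
    intro f
    filter_upwards [hV.le_add] with x hx
    rw [mul_pow, Real.sq_sqrt (by nlinarith [sq_nonneg x])]
  have hWL : ∀ n, MemLp (fun x => Real.sqrt (V x + (C + 1)) * (u n).1 x) 2 volume := by
    intro n
    refine (memLp_two_iff_integrable_sq (hWm.mul (u n).2.memLp.1)).2 ?_
    exact (integrable_shifted hV (u n)).congr (hWsq _).symm
  have hW2 : Tendsto (fun p : ℕ × ℕ => ∫ x, (Real.sqrt (V x + (C + 1)) * (u p.1).1 x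
      - Real.sqrt (V x + (C + 1)) * (u p.2).1 x) ^ 2) atTop (𝓝 0) := by
    refine squeeze_zero (fun p => integral_nonneg fun x => sq_nonneg _) (fun p => ?_) hc
    rw [energyForm_add_innerForm_self]
    have : ∫ x, (Real.sqrt (V x + (C + 1)) * (u p.1).1 x
      - Real.sqrt (V x + (C + 1)) * (u p.2).1 x) ^ 2
        = ∫ x, (V x + (C + 1)) * (u p.1 - u p.2).1 x ^ 2 := by
      rw [← integral_congr_ae (hWsq (u p.1 - u p.2).1)]
      refine integral_congr_ae (Eventually.of_forall fun x => ?_)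
      simp only [Submodule.coe_sub, Pi.sub_apply, mul_sub]
    rw [this]
    linarith [hn0 (deriv (u p.1 - u p.2).1)]
  obtain ⟨hwW, hWlim⟩ := tendsto_integral_sq_of_tendsto hWL hW2
    (fun x => (hw x).const_mul (Real.sqrt (V x + (C + 1))))
  have hwdom : InFormDomain V w :=
    { absolutelyContinuous := absolutelyContinuousOnInterval_of_eq_integral hloc hprim
      memLp := hwm
      memLp_deriv := (memLp_congr_ae hder).2 hg
      integrable_potential := by
        have i1 := hwW.integrable_sq.congr (hWsq w)
        refine (i1.sub (hwm.integrable_sq.const_mul (C + 1))).congr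
          (Eventually.of_forall fun x => ?_)
        simp only [Pi.sub_apply]
        ring }
  refine ⟨⟨w, hwdom⟩, ?_⟩
  have hfin := hglim.add hWlim
  rw [add_zero] at hfin
  refine hfin.congr fun n => ?_
  rw [energyForm_add_innerForm_self, hsub]
  congr 1
  · refine integral_congr_ae ?_
    filter_upwards [hder] with x hx
    rw [hx]
  · rw [← integral_congr_ae (hWsq (u n - ⟨w, hwdom⟩ : formDomain hV).1)]
    refine integral_congr_ae (Eventually.of_forall fun x => ?_)
    simp only [Submodule.coe_sub, Pi.sub_apply, mul_sub]

theorem isCompactForm_energyForm : IsCompactForm (energyForm hV) (innerForm hV) (C + 1) where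
  symm_a := fun u v => by
    rw [energyForm_apply, energyForm_apply]
    congr 1 <;> refine integral_congr_ae (Eventually.of_forall fun x => ?_) <;> ring
  symm_b := fun u v => by
    rw [innerForm_apply, innerForm_apply]
    refine integral_congr_ae (Eventually.of_forall fun x => ?_)
    ring
  pos_b := fun u hu => by
    -- Elements are continuous functions rather than classes, so one nonzero value forces a positive
    -- `L²` norm.
    have hne : ∃ x, u.1 x ≠ 0 := by
      by_contra! h
      exact hu (Subtype.ext (funext h))
    obtain ⟨x, hx⟩ := hne
    rw [innerForm_apply]
    exact integral_pos_of_integrable_nonneg_nonzero (x := x)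
      (u.2.continuous.mul u.2.continuous) (integrable_fun_mul u.2.memLp u.2.memLp)
      (fun y => mul_self_nonneg (u.1 y)) (mul_self_ne_zero.2 hx)
  le_add := fun u => by
    have := integral_parts_le hV u
    have e : innerForm hV u u = ∫ x, u.1 x ^ 2 :=
      integral_congr_ae (Eventually.of_forall fun x => (sq _).symm)
    rw [← e] at this
    linarith [integral_nonneg (μ := volume) (f := fun x => deriv u.1 x ^ 2) fun x => sq_nonneg _,
      integral_nonneg (μ := volume) (f := fun x => x ^ 2 * u.1 x ^ 2) fun x => by positivity]
  compact := fun u M hM => by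
    have hn0 : ∀ w : ℝ → ℝ, 0 ≤ ∫ x, w x ^ 2 := fun w => integral_nonneg fun x => sq_nonneg _
    have hn1 : ∀ w : ℝ → ℝ, 0 ≤ ∫ x, x ^ 2 * w x ^ 2 := fun w =>
      integral_nonneg fun x => by positivity
    have hp := fun n => (integral_parts_le hV (u n)).trans (hM n)
    have h0 : ∀ n, ∫ x, (u n).1 x ^ 2 ≤ M := fun n => by
      linarith [hp n, hn0 (deriv (u n).1), hn1 (u n).1]
    have h1 : ∀ n, ∫ x, deriv (u n).1 x ^ 2 ≤ M := fun n => by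
      linarith [hp n, hn0 (u n).1, hn1 (u n).1]
    have h2 : ∀ n, ∫ x, x ^ 2 * (u n).1 x ^ 2 ≤ M := fun n => by
      linarith [hp n, hn0 (u n).1, hn0 (deriv (u n).1)]
    obtain ⟨φ, hφ, hc⟩ := exists_subseq_pointwise_cauchy (fun n => (u n).2) h0 h1
    refine ⟨φ, hφ, ?_⟩
    have := tendsto_integral_sub_sq (fun n => (u (φ n)).2) (fun n => h0 (φ n))
      (fun n => h1 (φ n)) (fun n => integrable_sq_mul_sq hV (u (φ n))) (fun n => h2 (φ n)) hc
    refine this.congr fun p => ?_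
    rw [innerForm_apply]
    refine integral_congr_ae (Eventually.of_forall fun x => ?_)
    simp [sq]
  complete := exists_limit_energy hV

end Completeness

/-! ### Hermite functions: ladder relations, orthonormality, energy -/

section HermiteFunctions

open Polynomial

theorem integrable_polynomial_mul_gaussian (P : ℝ[X]) {c : ℝ} (hc : 0 < c) :
    Integrable (fun x => P.eval x * Real.exp (-c * x ^ 2)) volume := by
  induction P using Polynomial.induction_on' with
  | add P Q hP hQ =>
    refine (hP.add hQ).congr (Eventually.of_forall fun x => ?_)
    simp [add_mul]
  | monomial n r =>
    have h := (integrable_rpow_mul_exp_neg_mul_sq hc (s := n)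
      (by linarith [(n.cast_nonneg : (0 : ℝ) ≤ n)])).const_mul r
    refine h.congr (Eventually.of_forall fun x => ?_)
    simp [mul_assoc]

/-- The ladder coefficient `√(2(n+1))`. -/
def ladder (n : ℕ) : ℝ := Real.sqrt (2 * ((n : ℝ) + 1))

theorem ladder_pos (n : ℕ) : 0 < ladder n := Real.sqrt_pos.2 (by positivity)

theorem ladder_sq (n : ℕ) : ladder n ^ 2 = 2 * ((n : ℝ) + 1) := Real.sq_sqrt (by positivity)

/-- The normalized (physicists') Hermite polynomials. -/
def hermitePoly : ℕ → ℝ[X]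
  | 0 => C (Real.sqrt (1 / Real.sqrt Real.pi))
  | n + 1 => C (ladder n)⁻¹ * (2 * X * hermitePoly n - derivative (hermitePoly n))

theorem C_ladder_mul_hermitePoly_succ (n : ℕ) :
    C (ladder n) * hermitePoly (n + 1) = 2 * X * hermitePoly n - derivative (hermitePoly n) := by
  rw [hermitePoly, ← mul_assoc, ← C_mul, mul_inv_cancel₀ (ladder_pos n).ne', C_1, one_mul]

/-- Differentiating the defining recursion and inserting the previous case reproduces the recursion
itself, raising the factor `2(n + 1)` by `2` at each step. -/
theorem derivative_hermitePoly_succ (n : ℕ) :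
    derivative (hermitePoly (n + 1)) = C (ladder n) * hermitePoly n := by
  have key : ∀ n, C (ladder n) * derivative (hermitePoly (n + 1))
        = C (2 * ((n : ℝ) + 1)) * hermitePoly n →
      derivative (hermitePoly (n + 1)) = C (ladder n) * hermitePoly n := by
    intro n h
    have h2 : C (ladder n) * derivative (hermitePoly (n + 1))
        = C (ladder n) * (C (ladder n) * hermitePoly n) := by
      rw [h, ← ladder_sq, sq, C_mul, mul_assoc]
    exact mul_left_cancel₀ (C_ne_zero.2 (ladder_pos n).ne') h2
  induction n with
  | zero =>
    apply key
    rw [← derivative_C_mul, C_ladder_mul_hermitePoly_succ]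
    rw [hermitePoly, derivative_C, sub_zero]
    simp only [derivative_mul, derivative_C, derivative_X, derivative_ofNat, mul_zero, add_zero,
      zero_mul, zero_add, mul_one, Nat.cast_zero, C_ofNat]
  | succ n ih =>
    apply key
    have e1 : C (ladder (n + 1)) * derivative (hermitePoly (n + 1 + 1))
        = 2 * hermitePoly (n + 1) + (2 * X * derivative (hermitePoly (n + 1))
          - derivative (derivative (hermitePoly (n + 1)))) := by
      rw [← derivative_C_mul, C_ladder_mul_hermitePoly_succ]
      simp only [derivative_sub, derivative_mul, derivative_ofNat, derivative_X]
      ring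
    rw [e1, ih, derivative_C_mul]
    have e2 : 2 * X * (C (ladder n) * hermitePoly n)
        - C (ladder n) * derivative (hermitePoly n)
        = C (2 * ((n : ℝ) + 1)) * hermitePoly (n + 1) := by
      rw [← ladder_sq, sq, C_mul, mul_assoc (C (ladder n)), C_ladder_mul_hermitePoly_succ]
      ring
    rw [e2]
    push_cast
    simp only [C_mul, C_add, C_1, map_natCast, map_ofNat]
    ring

/-- The `L²`-normalized Hermite functions. -/
def hermiteFun (n : ℕ) (x : ℝ) : ℝ := (hermitePoly n).eval x * Real.exp (-x ^ 2 / 2)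

theorem hasDerivAt_polynomial_mul_gaussian (P : ℝ[X]) (x : ℝ) :
    HasDerivAt (fun x => P.eval x * Real.exp (-x ^ 2 / 2))
      ((derivative P).eval x * Real.exp (-x ^ 2 / 2)
        - x * (P.eval x * Real.exp (-x ^ 2 / 2))) x := by
  have h1 : HasDerivAt (fun x : ℝ => -x ^ 2 / 2) (-x) x := by
    refine (((hasDerivAt_pow 2 x).neg).div_const 2).congr_deriv ?_
    norm_num
    ring
  refine ((P.hasDerivAt x).mul h1.exp).congr_deriv ?_
  ring

theorem hasDerivAt_hermiteFun (n : ℕ) (x : ℝ) :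
    HasDerivAt (hermiteFun n) (x * hermiteFun n x - ladder n * hermiteFun (n + 1) x) x := by
  refine (hasDerivAt_polynomial_mul_gaussian (hermitePoly n) x).congr_deriv ?_
  have h := congrArg (eval x) (C_ladder_mul_hermitePoly_succ n)
  simp only [eval_mul, eval_C, eval_sub, eval_X, eval_ofNat] at h
  unfold hermiteFun
  rw [← mul_assoc (ladder n), h]
  ring

theorem hasDerivAt_hermiteFun_succ (n : ℕ) (x : ℝ) :
    HasDerivAt (hermiteFun (n + 1))
      (ladder n * hermiteFun n x - x * hermiteFun (n + 1) x) x := by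
  refine (hasDerivAt_polynomial_mul_gaussian (hermitePoly (n + 1)) x).congr_deriv ?_
  rw [derivative_hermitePoly_succ]
  simp only [eval_mul, eval_C, hermiteFun]
  ring

theorem hasDerivAt_hermiteFun_zero (x : ℝ) :
    HasDerivAt (hermiteFun 0) (-(x * hermiteFun 0 x)) x := by
  refine (hasDerivAt_polynomial_mul_gaussian (hermitePoly 0) x).congr_deriv ?_
  simp [hermitePoly, hermiteFun]

/-- The creation and annihilation formulas give two expressions for the derivative of `ψ_{n+1}`;
equating them yields the three-term recurrence. -/
theorem ladder_mul_hermiteFun_add_two (n : ℕ) (x : ℝ) :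
    ladder (n + 1) * hermiteFun (n + 2) x
      = 2 * x * hermiteFun (n + 1) x - ladder n * hermiteFun n x := by
  have := (hasDerivAt_hermiteFun (n + 1) x).unique (hasDerivAt_hermiteFun_succ n x)
  linarith

theorem continuous_hermiteFun (n : ℕ) : Continuous (hermiteFun n) := by
  unfold hermiteFun
  fun_prop

theorem exp_half_mul_self (x : ℝ) :
    Real.exp (-x ^ 2 / 2) * Real.exp (-x ^ 2 / 2) = Real.exp (-1 * x ^ 2) := by
  rw [← Real.exp_add]
  congr 1
  ring

theorem integrable_polynomial_mul_hermiteFun_mul (P : ℝ[X]) (i j : ℕ) :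
    Integrable (fun x => P.eval x * (hermiteFun i x * hermiteFun j x)) volume := by
  refine (integrable_polynomial_mul_gaussian (P * hermitePoly i * hermitePoly j)
    one_pos).congr (Eventually.of_forall fun x => ?_)
  simp only [eval_mul, hermiteFun]
  rw [← exp_half_mul_self]
  ring

theorem integrable_gaussian_mul_hermiteFun_mul (P : ℝ[X]) (i j : ℕ) :
    Integrable (fun x => Real.exp (-x ^ 2) * (P.eval x * (hermiteFun i x * hermiteFun j x)))
      volume := by
  refine (integrable_polynomial_mul_gaussian (P * hermitePoly i * hermitePoly j)
    two_pos).congr (Eventually.of_forall fun x => ?_)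
  simp only [eval_mul, hermiteFun]
  have : Real.exp (-2 * x ^ 2) = Real.exp (-x ^ 2) *
      (Real.exp (-x ^ 2 / 2) * Real.exp (-x ^ 2 / 2)) := by
    rw [← Real.exp_add, ← Real.exp_add]
    congr 1
    ring
  rw [this]
  ring

theorem integrable_hermiteFun_mul (i j : ℕ) :
    Integrable (fun x => hermiteFun i x * hermiteFun j x) volume := by
  simpa using integrable_polynomial_mul_hermiteFun_mul 1 i j

theorem integrable_id_mul_hermiteFun_mul (i j : ℕ) :
    Integrable (fun x => x * (hermiteFun i x * hermiteFun j x)) volume := by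
  simpa using integrable_polynomial_mul_hermiteFun_mul X i j

theorem integral_hermiteFun_zero_sq : ∫ x, hermiteFun 0 x * hermiteFun 0 x = 1 := by
  have h : ∀ x, hermiteFun 0 x * hermiteFun 0 x
      = 1 / Real.sqrt Real.pi * Real.exp (-1 * x ^ 2) := by
    intro x
    simp only [hermiteFun, hermitePoly, eval_C]
    rw [mul_mul_mul_comm, exp_half_mul_self, Real.mul_self_sqrt (by positivity)]
  simp_rw [h]
  rw [integral_const_mul, integral_gaussian, div_one,
    one_div, inv_mul_cancel₀ (Real.sqrt_pos.2 Real.pi_pos).ne']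

/-- The creation operator is adjoint to the annihilation operator. -/
theorem integral_hermiteFun_succ_mul (i j : ℕ) :
    ladder i * (∫ x, hermiteFun (i + 1) x * hermiteFun (j + 1) x)
      = ladder j * ∫ x, hermiteFun i x * hermiteFun j x := by
  have hd : ∀ x, HasDerivAt (fun x => hermiteFun i x * hermiteFun (j + 1) x)
      (ladder j * (hermiteFun i x * hermiteFun j x)
        - ladder i * (hermiteFun (i + 1) x * hermiteFun (j + 1) x)) x := fun x =>
    ((hasDerivAt_hermiteFun i x).mul (hasDerivAt_hermiteFun_succ j x)).congr_deriv (by ring)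
  have i1 := (integrable_hermiteFun_mul i j).const_mul (ladder j)
  have i2 := (integrable_hermiteFun_mul (i + 1) (j + 1)).const_mul (ladder i)
  have h := integral_eq_zero_of_hasDerivAt_of_integrable hd (i1.sub i2)
    (integrable_hermiteFun_mul i (j + 1))
  rw [integral_sub i1 i2, integral_const_mul, integral_const_mul] at h
  linarith

theorem integral_hermiteFun_succ_mul_zero (i : ℕ) :
    ∫ x, hermiteFun (i + 1) x * hermiteFun 0 x = 0 := by
  have hd : ∀ x, HasDerivAt (fun x => hermiteFun i x * hermiteFun 0 x)
      (-(ladder i) * (hermiteFun (i + 1) x * hermiteFun 0 x)) x := fun x =>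
    ((hasDerivAt_hermiteFun i x).mul (hasDerivAt_hermiteFun_zero x)).congr_deriv (by ring)
  have h := integral_eq_zero_of_hasDerivAt_of_integrable hd
    ((integrable_hermiteFun_mul (i + 1) 0).const_mul _) (integrable_hermiteFun_mul i 0)
  rw [integral_const_mul] at h
  exact (mul_eq_zero.1 h).resolve_left (neg_ne_zero.2 (ladder_pos i).ne')

/-- The adjoint relation lowers both indices together, down to the ground state. -/
theorem integral_hermiteFun_mul (i j : ℕ) :
    ∫ x, hermiteFun i x * hermiteFun j x = if i = j then 1 else 0 := by
  induction i generalizing j with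
  | zero =>
    cases j with
    | zero => simpa using integral_hermiteFun_zero_sq
    | succ j =>
      rw [if_neg (by omega), ← integral_hermiteFun_succ_mul_zero j]
      simp_rw [mul_comm]
  | succ i ih =>
    cases j with
    | zero => rw [if_neg (by omega), integral_hermiteFun_succ_mul_zero]
    | succ j =>
      have h := integral_hermiteFun_succ_mul i j
      rw [ih j] at h
      by_cases hij : i = j
      · subst hij
        simp only [if_true, mul_one] at h ⊢
        exact mul_left_cancel₀ (ladder_pos i).ne' (by rw [h, mul_one])
      · rw [if_neg hij, mul_zero] at h
        rw [if_neg (by omega)]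
        exact (mul_eq_zero.1 h).resolve_left (ladder_pos i).ne'

/-- The energy of the `n`-th Hermite function for the harmonic oscillator. -/
theorem integral_hermiteFun_energy (n : ℕ) :
    Integrable (fun x => deriv (hermiteFun n) x * deriv (hermiteFun n) x) volume ∧
    Integrable (fun x => x ^ 2 * hermiteFun n x * hermiteFun n x) volume ∧
    (∫ x, deriv (hermiteFun n) x * deriv (hermiteFun n) x)
      + (∫ x, x ^ 2 * hermiteFun n x * hermiteFun n x) = lamZero n := by
  have e : ∀ x, deriv (hermiteFun n) x = x * hermiteFun n x - ladder n * hermiteFun (n + 1) x :=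
    fun x => (hasDerivAt_hermiteFun n x).deriv
  have i2 : Integrable (fun x => x ^ 2 * hermiteFun n x * hermiteFun n x) volume := by
    refine (integrable_polynomial_mul_hermiteFun_mul (X * X) n n).congr
      (Eventually.of_forall fun x => ?_)
    simp only [eval_mul, eval_X]
    ring
  have j1 := integrable_id_mul_hermiteFun_mul n (n + 1)
  have j2 := integrable_hermiteFun_mul (n + 1) (n + 1)
  have j3 := integrable_hermiteFun_mul n n
  have i1 : Integrable (fun x => deriv (hermiteFun n) x * deriv (hermiteFun n) x) volume := by
    refine ((i2.sub (j1.const_mul (2 * ladder n))).add (j2.const_mul (ladder n ^ 2))).congr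
      (Eventually.of_forall fun x => ?_)
    simp only [Pi.add_apply, Pi.sub_apply, e]
    ring
  refine ⟨i1, i2, ?_⟩
  have hd : ∀ x, HasDerivAt (fun x => x * (hermiteFun n x * hermiteFun n x))
      (hermiteFun n x * hermiteFun n x + (2 * (x ^ 2 * hermiteFun n x * hermiteFun n x)
        - 2 * ladder n * (x * (hermiteFun n x * hermiteFun (n + 1) x)))) x := fun x =>
    ((hasDerivAt_id x).mul ((hasDerivAt_hermiteFun n x).mul
      (hasDerivAt_hermiteFun n x))).congr_deriv (by simp; ring)
  have k1 : Integrable (fun x => hermiteFun n x * hermiteFun n x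
      + (2 * (x ^ 2 * hermiteFun n x * hermiteFun n x)
        - 2 * ladder n * (x * (hermiteFun n x * hermiteFun (n + 1) x)))) volume :=
    j3.add ((i2.const_mul 2).sub (j1.const_mul (2 * ladder n)))
  have k2 : Integrable (fun x => ladder n ^ 2 * (hermiteFun (n + 1) x * hermiteFun (n + 1) x)
      - hermiteFun n x * hermiteFun n x) volume := (j2.const_mul _).sub j3
  have h := integral_eq_zero_of_hasDerivAt_of_integrable hd k1
    (integrable_id_mul_hermiteFun_mul n n)
  -- With `ℓ` the ladder coefficient, `ψ_n'² + x² ψ_n² = (x ψ_n²)' + ℓ² ψ_{n+1}² - ψ_n²`. The total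
  -- derivative integrates to zero, leaving `2(n + 1) - 1`.
  have e2 : (∫ x, deriv (hermiteFun n) x * deriv (hermiteFun n) x)
      + (∫ x, x ^ 2 * hermiteFun n x * hermiteFun n x)
      = (∫ x, (hermiteFun n x * hermiteFun n x + (2 * (x ^ 2 * hermiteFun n x * hermiteFun n x)
        - 2 * ladder n * (x * (hermiteFun n x * hermiteFun (n + 1) x)))))
        + ((∫ x, ladder n ^ 2 * (hermiteFun (n + 1) x * hermiteFun (n + 1) x))
          - ∫ x, hermiteFun n x * hermiteFun n x) := by
    rw [← integral_add i1 i2, ← integral_sub (j2.const_mul _) j3,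
      ← integral_add k1 k2]
    refine integral_congr_ae (Eventually.of_forall fun x => ?_)
    simp only [e]
    ring
  rw [e2, h, integral_const_mul, integral_hermiteFun_mul, integral_hermiteFun_mul, ladder_sq,
    lamZero]
  simp
  ring

/-! ### The Hermite density: sup bound and Gaussian average -/

section Density

/-- The density `∑_{k ≤ n} ψ_k²` of the first Hermite functions. -/
def density (n : ℕ) (x : ℝ) : ℝ := ∑ k ∈ Finset.range (n + 1), hermiteFun k x ^ 2

/-- The Christoffel–Darboux formula on the diagonal. -/
theorem density_eq (n : ℕ) (x : ℝ) :
    density n x = ((n : ℝ) + 1) * (hermiteFun n x ^ 2 + hermiteFun (n + 1) x ^ 2)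
      - ladder n * (x * (hermiteFun n x * hermiteFun (n + 1) x)) := by
  induction n with
  | zero =>
    have h : ladder 0 * hermiteFun 1 x = 2 * x * hermiteFun 0 x := by
      have := (hasDerivAt_hermiteFun 0 x).unique (hasDerivAt_hermiteFun_zero x)
      linarith
    have h2 : ladder 0 ^ 2 = 2 := by simpa using ladder_sq 0
    have h3 : hermiteFun 1 x ^ 2 = x * ladder 0 * (hermiteFun 0 x * hermiteFun 1 x) := by
      have : ladder 0 ^ 2 * hermiteFun 1 x ^ 2
          = (ladder 0 * hermiteFun 1 x) * (2 * x * hermiteFun 0 x) := by rw [← h]; ring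
      rw [h2] at this
      linarith
    simp [density]
    linarith
  | succ n ih =>
    have h := ladder_mul_hermiteFun_add_two n x
    have s1 := ladder_sq n
    have s2 := ladder_sq (n + 1)
    rw [density, Finset.sum_range_succ, ← density, ih]
    -- The recurrence squared, and multiplied by `2 x ψ_{n+1}`, eliminates the two monomials
    -- containing `ψ_{n+2}` in the target.
    have h2 : (ladder (n + 1) * hermiteFun (n + 2) x) ^ 2
        = (2 * x * hermiteFun (n + 1) x - ladder n * hermiteFun n x) ^ 2 := by rw [h]
    have h3 : (ladder (n + 1) * hermiteFun (n + 2) x) * (2 * x * hermiteFun (n + 1) x)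
        = (2 * x * hermiteFun (n + 1) x - ladder n * hermiteFun n x)
          * (2 * x * hermiteFun (n + 1) x) := by rw [h]
    rw [mul_pow, s2] at h2
    have h4 : (2 * x * hermiteFun (n + 1) x - ladder n * hermiteFun n x) ^ 2
        = 4 * x ^ 2 * hermiteFun (n + 1) x ^ 2
          - 4 * ladder n * x * (hermiteFun n x * hermiteFun (n + 1) x)
          + ladder n ^ 2 * hermiteFun n x ^ 2 := by ring
    rw [h4, s1] at h2
    push_cast at h2 ⊢
    linarith

theorem hasDerivAt_density_add (n : ℕ) (x : ℝ) :
    HasDerivAt (fun x => density n x + hermiteFun (n + 1) x ^ 2 / 2)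
      (-(x * hermiteFun (n + 1) x ^ 2)) x := by
  have e : (fun x => density n x + hermiteFun (n + 1) x ^ 2 / 2) = fun x =>
      ((n : ℝ) + 1) * (hermiteFun n x ^ 2 + hermiteFun (n + 1) x ^ 2)
      - ladder n * (x * (hermiteFun n x * hermiteFun (n + 1) x))
      + hermiteFun (n + 1) x ^ 2 / 2 := by
    ext x
    rw [density_eq]
  rw [e]
  have ha := hasDerivAt_hermiteFun n x
  have hb := hasDerivAt_hermiteFun_succ n x
  have h := ((((ha.pow 2).add (hb.pow 2)).const_mul ((n : ℝ) + 1)).sub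
    (((hasDerivAt_id x).mul (ha.mul hb)).const_mul (ladder n))).add ((hb.pow 2).div_const 2)
  refine h.congr_deriv ?_
  have s1 := ladder_sq n
  have s2 : (n : ℝ) + 1 = ladder n ^ 2 / 2 := by rw [s1]; ring
  rw [s2]
  simp
  ring

/-- `ρ_n + ψ_{n+1}²/2` attains its maximum at the origin. -/
theorem density_le (n : ℕ) (x : ℝ) :
    density n x ≤ density n 0 + hermiteFun (n + 1) 0 ^ 2 / 2 := by
  set F : ℝ → ℝ := fun x => density n x + hermiteFun (n + 1) x ^ 2 / 2 with hF
  have hd := hasDerivAt_density_add n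
  have hc : Continuous F := continuous_iff_continuousAt.2 fun x => (hd x).continuousAt
  have hpos : AntitoneOn F (Set.Ici 0) :=
    antitoneOn_of_deriv_nonpos (convex_Ici 0) hc.continuousOn
      (fun x _ => (hd x).differentiableAt.differentiableWithinAt) fun x hx => by
        rw [interior_Ici, Set.mem_Ioi] at hx
        rw [(hd x).deriv]
        have := mul_nonneg hx.le (sq_nonneg (hermiteFun (n + 1) x))
        linarith
  have hneg : MonotoneOn F (Set.Iic 0) :=
    monotoneOn_of_deriv_nonneg (convex_Iic 0) hc.continuousOn
      (fun x _ => (hd x).differentiableAt.differentiableWithinAt) fun x hx => by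
        rw [interior_Iic, Set.mem_Iio] at hx
        rw [(hd x).deriv]
        have := mul_nonneg (neg_nonneg.2 hx.le) (sq_nonneg (hermiteFun (n + 1) x))
        linarith
  have hle : F x ≤ F 0 := by
    rcases le_total 0 x with h | h
    · exact hpos Set.self_mem_Ici h h
    · exact hneg h Set.self_mem_Iic h
  have : density n x ≤ F x := by
    simp only [hF]
    linarith [sq_nonneg (hermiteFun (n + 1) x)]
  exact this.trans hle

theorem hermiteFun_add_two_zero_sq (n : ℕ) :
    ((n : ℝ) + 2) * hermiteFun (n + 2) 0 ^ 2 = ((n : ℝ) + 1) * hermiteFun n 0 ^ 2 := by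
  have h := ladder_mul_hermiteFun_add_two n 0
  have h2 : (ladder (n + 1) * hermiteFun (n + 2) 0) ^ 2 = (ladder n * hermiteFun n 0) ^ 2 := by
    rw [h]; ring
  rw [mul_pow, mul_pow, ladder_sq, ladder_sq] at h2
  push_cast at h2
  linarith

theorem hermiteFun_odd_zero (m : ℕ) : hermiteFun (2 * m + 1) 0 = 0 := by
  induction m with
  | zero =>
    have := (hasDerivAt_hermiteFun 0 0).unique (hasDerivAt_hermiteFun_zero 0)
    simp [(ladder_pos 0).ne'] at this
    simpa using this
  | succ m ih =>
    have h := hermiteFun_add_two_zero_sq (2 * m + 1)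
    rw [ih] at h
    have h2 : hermiteFun (2 * m + 1 + 2) 0 ^ 2 = 0 := by
      have h0 : ((2 * m + 1 : ℕ) : ℝ) + 2 ≠ 0 := by positivity
      refine (mul_eq_zero.1 (h.trans ?_)).resolve_left h0
      ring
    simpa [show 2 * (m + 1) + 1 = 2 * m + 1 + 2 by ring] using h2

/-- The recurrence at the origin, `(n + 2) ψ_{n+2}(0)² = (n + 1) ψ_n(0)²`, is the functional
equation of this Gamma quotient. -/
theorem hermiteFun_even_zero_sq (m : ℕ) :
    hermiteFun (2 * m) 0 ^ 2
      = Real.Gamma ((m : ℝ) + 1 / 2) / Real.Gamma ((m : ℝ) + 1) / Real.pi := by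
  induction m with
  | zero =>
    have hp := Real.sqrt_pos.2 Real.pi_pos
    have : Real.sqrt Real.pi * Real.sqrt Real.pi = Real.pi := Real.mul_self_sqrt Real.pi_pos.le
    simp only [hermiteFun, hermitePoly, eval_C, Nat.cast_zero, zero_add, Real.Gamma_one,
      div_one]
    rw [Real.Gamma_one_half_eq]
    simp
    rw [inv_eq_iff_eq_inv, inv_div, eq_div_iff hp.ne', this]
  | succ m ih =>
    have h := hermiteFun_add_two_zero_sq (2 * m)
    rw [ih] at h
    have g1 : Real.Gamma ((m : ℝ) + 1 / 2 + 1) = ((m : ℝ) + 1 / 2) * Real.Gamma ((m : ℝ) + 1 / 2) :=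
      Real.Gamma_add_one (by positivity)
    have g2 : Real.Gamma ((m : ℝ) + 1 + 1) = ((m : ℝ) + 1) * Real.Gamma ((m : ℝ) + 1) :=
      Real.Gamma_add_one (by positivity)
    have g3 : 0 < Real.Gamma ((m : ℝ) + 1) := Real.Gamma_pos_of_pos (by positivity)
    rw [show 2 * (m + 1) = 2 * m + 2 by ring]
    push_cast at h ⊢
    rw [show (m : ℝ) + 1 + 1 / 2 = (m : ℝ) + 1 / 2 + 1 by ring, g1, g2]
    have h0 : 2 * (m : ℝ) + 2 ≠ 0 := by positivity
    refine mul_left_cancel₀ h0 (h.trans ?_)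
    have := Real.pi_pos.ne'
    field_simp

/-- This is the origin of the two cases of `ω_n`. Odd Hermite functions vanish at `0`, so only `(n +
1) ψ_n(0)²` survives for even `n`, and only `(n + 3/2) ψ_{n+1}(0)²` for odd `n`. -/
theorem density_zero_add (n : ℕ) :
    density n 0 + hermiteFun (n + 1) 0 ^ 2 / 2 = omega n / Real.pi := by
  have hpi := Real.pi_pos.ne'
  rw [density_eq, omega]
  rcases Nat.even_or_odd' n with ⟨m, rfl | rfl⟩
  · rw [hermiteFun_odd_zero, hermiteFun_even_zero_sq, if_neg (by simp)]
    push_cast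
    rw [show (2 * (m : ℝ) + 1) / 2 = (m : ℝ) + 1 / 2 by ring,
      show 2 * (m : ℝ) / 2 + 1 = (m : ℝ) + 1 by ring]
    ring
  · rw [hermiteFun_odd_zero, show 2 * m + 1 + 1 = 2 * (m + 1) by ring, hermiteFun_even_zero_sq,
      if_pos (by simp)]
    push_cast
    have g2 : Real.Gamma ((m : ℝ) + 1 + 1) = ((m : ℝ) + 1) * Real.Gamma ((m : ℝ) + 1) :=
      Real.Gamma_add_one (by positivity)
    have g3 : 0 < Real.Gamma ((m : ℝ) + 1) := Real.Gamma_pos_of_pos (by positivity)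
    rw [show (2 * (m : ℝ) + 1) / 2 + 1 = (m : ℝ) + 1 + 1 / 2 by ring,
      show (2 * (m : ℝ) + 1 + 1) / 2 = (m : ℝ) + 1 by ring, g2]
    field_simp
    ring

theorem density_le_omega (n : ℕ) (x : ℝ) : density n x ≤ omega n / Real.pi :=
  (density_le n x).trans_eq (density_zero_add n)

theorem integrable_gaussian_mul_density (n : ℕ) :
    Integrable (fun x => Real.exp (-x ^ 2) * density n x) volume := by
  simp only [density, Finset.mul_sum]
  refine integrable_finsetSum _ fun k _ => ?_
  simpa [sq] using integrable_gaussian_mul_hermiteFun_mul 1 k k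

/-- Integrating the derivative of `exp(-x²) ψ_n ψ_{n+1}` expresses the cross term of
Christoffel–Darboux through the averages of `ψ_n²` and `ψ_{n+1}²`; the `ψ_n²` contributions then
cancel. -/
theorem integral_gaussian_mul_density_eq (n : ℕ) :
    ∫ x, Real.exp (-x ^ 2) * density n x
      = 2 * ((n : ℝ) + 1) * ∫ x, Real.exp (-x ^ 2) * hermiteFun (n + 1) x ^ 2 := by
  have jn : ∀ k, Integrable (fun x => Real.exp (-x ^ 2) * hermiteFun k x ^ 2) volume := fun k => by
    simpa [sq] using integrable_gaussian_mul_hermiteFun_mul 1 k k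
  have jx : Integrable (fun x =>
      Real.exp (-x ^ 2) * (x * (hermiteFun n x * hermiteFun (n + 1) x))) volume := by
    simpa using integrable_gaussian_mul_hermiteFun_mul X n (n + 1)
  have j0 : Integrable (fun x =>
      Real.exp (-x ^ 2) * (hermiteFun n x * hermiteFun (n + 1) x)) volume := by
    simpa using integrable_gaussian_mul_hermiteFun_mul 1 n (n + 1)
  have hd : ∀ x, HasDerivAt (fun x => Real.exp (-x ^ 2) * (hermiteFun n x * hermiteFun (n + 1) x))
      ((ladder n * (Real.exp (-x ^ 2) * hermiteFun n x ^ 2)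
        - ladder n * (Real.exp (-x ^ 2) * hermiteFun (n + 1) x ^ 2))
        - 2 * (Real.exp (-x ^ 2) * (x * (hermiteFun n x * hermiteFun (n + 1) x)))) x := fun x => by
    have h1 : HasDerivAt (fun x : ℝ => -x ^ 2) (-(2 * x)) x := by
      exact (hasDerivAt_pow 2 x).neg.congr_deriv (by simp)
    refine (h1.exp.mul ((hasDerivAt_hermiteFun n x).mul
      (hasDerivAt_hermiteFun_succ n x))).congr_deriv ?_
    rw [Pi.mul_apply]
    ring
  have k1 : Integrable (fun x => ladder n * (Real.exp (-x ^ 2) * hermiteFun n x ^ 2)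
      - ladder n * (Real.exp (-x ^ 2) * hermiteFun (n + 1) x ^ 2)) volume :=
    ((jn n).const_mul (ladder n)).sub ((jn (n + 1)).const_mul (ladder n))
  have h := integral_eq_zero_of_hasDerivAt_of_integrable hd (k1.sub (jx.const_mul 2)) j0
  rw [integral_sub k1 (jx.const_mul 2), integral_sub ((jn n).const_mul _)
    ((jn (n + 1)).const_mul _), integral_const_mul, integral_const_mul, integral_const_mul] at h
  have e : ∫ x, Real.exp (-x ^ 2) * density n x
      = ∫ x, ((((n : ℝ) + 1) * (Real.exp (-x ^ 2) * hermiteFun n x ^ 2)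
        + ((n : ℝ) + 1) * (Real.exp (-x ^ 2) * hermiteFun (n + 1) x ^ 2))
        - ladder n * (Real.exp (-x ^ 2) * (x * (hermiteFun n x * hermiteFun (n + 1) x)))) := by
    refine integral_congr_ae (Eventually.of_forall fun x => ?_)
    simp only [density_eq]
    ring
  have k2 : Integrable (fun x => ((n : ℝ) + 1) * (Real.exp (-x ^ 2) * hermiteFun n x ^ 2)
      + ((n : ℝ) + 1) * (Real.exp (-x ^ 2) * hermiteFun (n + 1) x ^ 2)) volume :=
    ((jn n).const_mul ((n : ℝ) + 1)).add ((jn (n + 1)).const_mul ((n : ℝ) + 1))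
  rw [e, integral_sub k2 (jx.const_mul _), integral_add ((jn n).const_mul _)
    ((jn (n + 1)).const_mul _), integral_const_mul, integral_const_mul, integral_const_mul]
  have s1 := ladder_sq n
  set B := ∫ x, Real.exp (-x ^ 2) * (x * (hermiteFun n x * hermiteFun (n + 1) x))
  set A := ∫ x, Real.exp (-x ^ 2) * hermiteFun n x ^ 2
  set A' := ∫ x, Real.exp (-x ^ 2) * hermiteFun (n + 1) x ^ 2
  have h3 : ladder n * B = ladder n ^ 2 * (A - A') / 2 := by
    have : B = ladder n * (A - A') / 2 := by linarith
    rw [this]; ring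
  rw [h3, s1]
  ring

/-- The preceding identity turns the increment from `ρ_n` to `ρ_{n+1}` into a fraction of the
average of `ρ_n`, so the average is multiplied by `1 + 1 / (2(n + 1)) = (n + 3/2) / (n + 1)`. -/
theorem integral_gaussian_mul_density (n : ℕ) :
    ∫ x, Real.exp (-x ^ 2) * density n x
      = Real.sqrt 2 * (Real.Gamma ((n : ℝ) + 3 / 2) / Real.Gamma ((n : ℝ) + 1))
        / Real.sqrt Real.pi := by
  induction n with
  | zero =>
    have h : ∀ x, Real.exp (-x ^ 2) * density 0 x
        = 1 / Real.sqrt Real.pi * Real.exp (-2 * x ^ 2) := by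
      intro x
      simp only [density, zero_add, Finset.sum_range_one, hermiteFun, hermitePoly, eval_C]
      rw [mul_pow, sq (Real.exp _), exp_half_mul_self, Real.sq_sqrt (by positivity),
        mul_left_comm, ← Real.exp_add]
      congr 2
      ring
    simp_rw [h]
    rw [integral_const_mul, integral_gaussian, Nat.cast_zero, zero_add, zero_add, Real.Gamma_one,
      div_one, show (3 / 2 : ℝ) = 1 / 2 + 1 by norm_num, Real.Gamma_add_one (by norm_num),
      Real.Gamma_one_half_eq, Real.sqrt_div Real.pi_pos.le]
    have hp := (Real.sqrt_pos.2 Real.pi_pos).ne'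
    have h2 : Real.sqrt 2 ^ 2 = 2 := Real.sq_sqrt (by norm_num)
    have h20 : Real.sqrt 2 ≠ 0 := by positivity
    field_simp
    linarith
  | succ n ih =>
    have jn : Integrable (fun x => Real.exp (-x ^ 2) * hermiteFun (n + 1) x ^ 2) volume := by
      simpa [sq] using integrable_gaussian_mul_hermiteFun_mul 1 (n + 1) (n + 1)
    have e : ∫ x, Real.exp (-x ^ 2) * density (n + 1) x
        = (∫ x, Real.exp (-x ^ 2) * density n x)
          + ∫ x, Real.exp (-x ^ 2) * hermiteFun (n + 1) x ^ 2 := by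
      rw [← integral_add (integrable_gaussian_mul_density n) jn]
      refine integral_congr_ae (Eventually.of_forall fun x => ?_)
      simp only [density]
      rw [Finset.sum_range_succ _ (n + 1)]
      ring
    have h := integral_gaussian_mul_density_eq n
    have h2 : ∫ x, Real.exp (-x ^ 2) * hermiteFun (n + 1) x ^ 2
        = (∫ x, Real.exp (-x ^ 2) * density n x) / (2 * ((n : ℝ) + 1)) := by
      rw [h]
      field_simp
    rw [e, h2, ih]
    have g1 : Real.Gamma ((n : ℝ) + 3 / 2 + 1) = ((n : ℝ) + 3 / 2) * Real.Gamma ((n : ℝ) + 3 / 2) :=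
      Real.Gamma_add_one (by positivity)
    have g2 : Real.Gamma ((n : ℝ) + 1 + 1) = ((n : ℝ) + 1) * Real.Gamma ((n : ℝ) + 1) :=
      Real.Gamma_add_one (by positivity)
    have g3 : 0 < Real.Gamma ((n : ℝ) + 1) := Real.Gamma_pos_of_pos (by positivity)
    push_cast
    rw [show (n : ℝ) + 1 + 3 / 2 = (n : ℝ) + 3 / 2 + 1 by ring, g1, g2]
    have hp := (Real.sqrt_pos.2 Real.pi_pos).ne'
    field_simp
    ring

end Density

end HermiteFunctions

/-! ### Ky Fan bound for the listed eigenvalues -/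

theorem linearIndependent_of_form_orthonormal {E ι : Type*} [AddCommGroup E] [Module ℝ E]
    [DecidableEq ι] (b : E →ₗ[ℝ] E →ₗ[ℝ] ℝ) {v : ι → E}
    (hv : ∀ i j, b (v i) (v j) = if i = j then 1 else 0) : LinearIndependent ℝ v := by
  rw [linearIndependent_iff']
  intro s g hg i hi
  have h := congrArg (b (v i)) hg
  simp only [map_sum, map_smul, smul_eq_mul, hv, mul_ite, mul_one, mul_zero, Finset.sum_ite_eq,
    hi, if_true, map_zero] at h
  exact h

section EigenvalueSums

variable {V : ℝ → ℝ} {C : ℝ} (hV : IsConfining V C)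

/-- The `e i` with `m i = μ` are orthonormal, hence independent, weak eigenfunctions. A lower bound
on the dimension is enough for the comparison `lam k ≤ m k`. -/
theorem encard_le_rank_eigenspace {n : ℕ} {e : ℕ → formDomain hV} {m : ℕ → ℝ}
    (hon : ∀ i < n + 1, ∀ j < n + 1, innerForm hV (e i) (e j) = if i = j then 1 else 0)
    (heig : ∀ i < n + 1, ∀ v, energyForm hV (e i) v = m i * innerForm hV (e i) v)
    {k : ℕ} (hk : k ≤ n) (μ : ℝ) :
    {i | i ≤ k ∧ m i = μ}.encard ≤ Cardinal.toENat (Module.rank ℝ (eigenspace V μ)) := by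
  set T : Finset ℕ := (Finset.range (k + 1)).filter fun i => m i = μ with hT
  have hTlt : ∀ i ∈ T, i < n + 1 := fun i hi => by
    have := Finset.mem_range.1 (Finset.mem_filter.1 hi).1
    omega
  have hset : {i | i ≤ k ∧ m i = μ} = (T : Set ℕ) := by
    ext i
    simp [hT]
  have hmem : ∀ i : T, (e i).1 ∈ eigenspace V μ := fun i =>
    { inFormDomain := (e i).2
      integrable_mul := fun φ hφ => hV.integrable_mul_mul (e i).2 hφ
      weak_eq := fun φ hφ => by
        have h := heig i (hTlt i i.2) ⟨φ, hφ⟩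
        rw [(Finset.mem_filter.1 i.2).2, energyForm_apply, innerForm_apply] at h
        exact h }
  have hli : LinearIndependent ℝ fun i : T => e i :=
    linearIndependent_of_form_orthonormal (innerForm hV) fun i j => by
      rw [hon i (hTlt i i.2) j (hTlt j j.2)]
      by_cases h : i = j
      · rw [if_pos h, if_pos (congrArg _ h)]
      · rw [if_neg h, if_neg fun h' => h (Subtype.ext h')]
  have hli2 : LinearIndependent ℝ fun i : T => (⟨(e i).1, hmem i⟩ : eigenspace V μ) := by
    refine LinearIndependent.of_comp (eigenspace V μ).subtype ?_
    exact hli.map' (formDomain hV).subtype (Submodule.ker_subtype _)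
  have hrank := hli2.cardinal_le_rank
  rw [hset, Set.encard_coe_eq_coe_finsetCard, Cardinal.natCast_le_toENat]
  simpa using hrank

/-- The sum of the lowest `n + 1` listed eigenvalues is at most the sum of the energies of any
orthonormal family. -/
theorem sum_eigenvalueSequence_le {lam : ℕ → ℝ} (hlam : IsEigenvalueSequence V lam)
    {ψ : ℕ → formDomain hV} (hψ : ∀ i j, innerForm hV (ψ i) (ψ j) = if i = j then 1 else 0)
    (n : ℕ) :
    ∑ k ∈ Finset.range (n + 1), lam k
      ≤ ∑ k ∈ Finset.range (n + 1), energyForm hV (ψ k) (ψ k) := by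
  have hcf := isCompactForm_energyForm hV
  have hinf : ¬ Module.Finite ℝ (formDomain hV) := fun _ =>
    not_finite_iff_infinite.2 (inferInstance : Infinite ℕ)
      (linearIndependent_of_form_orthonormal (innerForm hV) hψ).finite_of_isNoetherian
  obtain ⟨e, m, hon, heig, hmin⟩ := hcf.exists_eigenpairs hinf (n + 1)
  refine le_trans (Finset.sum_le_sum fun k hk => ?_)
    (hcf.sum_eigenvalues_le hon heig hmin hψ)
  have hk : k < n + 1 := Finset.mem_range.1 hk
  refine le_of_encard_le hlam.monotone (fun i hi => ?_) fun μ => ?_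
  -- The later eigenvector `e k` is a competitor in the `i`-th minimization, so `m i ≤ m k`.
  · have h1 := hmin i (by omega) (e k) fun j hj => by
      rw [hon j (by omega) k hk, if_neg (by omega)]
    rw [heig k hk, hon k hk k hk] at h1
    simpa using h1
  · rw [hlam.multiplicity μ]
    exact encard_le_rank_eigenspace hV hon heig (Nat.lt_succ_iff.1 hk) μ

end EigenvalueSums

/-! ### First-order effect of the perturbation `q` -/

section Perturbation

variable {q : ℝ → ℝ} {qm : ℝ}

theorem isConfining_potential (hq : Integrable q volume) (hqm : 0 ≤ qm)
    (hqpos : ∀ᵐ x, 0 ≤ q x + qm * Real.exp (-x ^ 2)) : IsConfining (potential q) qm where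
  aestronglyMeasurable :=
    (continuous_id.pow 2).aestronglyMeasurable.add hq.aestronglyMeasurable
  le_add := by
    filter_upwards [hqpos] with x hx
    have h1 : Real.exp (-x ^ 2) ≤ 1 := Real.exp_le_one_iff.2 (neg_nonpos.2 (sq_nonneg x))
    have h2 := mul_le_mul_of_nonneg_left h1 hqm
    simp only [potential]
    linarith

theorem hermiteFun_sq_le_density (n : ℕ) (x : ℝ) : hermiteFun n x ^ 2 ≤ density n x :=
  Finset.single_le_sum (f := fun k => hermiteFun k x ^ 2) (fun _ _ => sq_nonneg _)
    (Finset.self_mem_range_succ n)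

theorem integrable_mul_hermiteFun_sq (hq : Integrable q volume) (n : ℕ) :
    Integrable (fun x => q x * hermiteFun n x ^ 2) volume := by
  refine hq.mul_bdd (c := omega n / Real.pi)
    ((continuous_hermiteFun n).pow 2).aestronglyMeasurable (Eventually.of_forall fun x => ?_)
  rw [Real.norm_eq_abs, abs_of_nonneg (sq_nonneg _)]
  exact (hermiteFun_sq_le_density n x).trans (density_le_omega n x)

theorem inFormDomain_hermiteFun (hq : Integrable q volume) (n : ℕ) :
    InFormDomain (potential q) (hermiteFun n) where
  absolutelyContinuous := fun a b => by
    refine ContDiffOn.absolutelyContinuousOnInterval (ContDiff.contDiffOn ?_)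
    have h := Polynomial.contDiff_aeval (𝕜 := ℝ) (hermitePoly n) 1
    simp only [Polynomial.coe_aeval_eq_eval] at h
    exact h.mul (by fun_prop)
  memLp := by
    rw [memLp_two_iff_integrable_sq (continuous_hermiteFun n).aestronglyMeasurable]
    simpa [sq] using integrable_hermiteFun_mul n n
  memLp_deriv := by
    rw [memLp_two_iff_integrable_sq (measurable_deriv _).aestronglyMeasurable]
    simpa [sq] using (integral_hermiteFun_energy n).1
  integrable_potential := by
    refine ((integral_hermiteFun_energy n).2.1.add (integrable_mul_hermiteFun_sq hq n)).congr
      (Eventually.of_forall fun x => ?_)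
    simp only [Pi.add_apply, potential]
    ring

theorem energyForm_hermiteFun {C : ℝ} (hV : IsConfining (potential q) C)
    (hq : Integrable q volume) (n : ℕ) :
    energyForm hV ⟨hermiteFun n, inFormDomain_hermiteFun hq n⟩
      ⟨hermiteFun n, inFormDomain_hermiteFun hq n⟩
      = lamZero n + ∫ x, q x * hermiteFun n x ^ 2 := by
  obtain ⟨-, i2, h⟩ := integral_hermiteFun_energy n
  rw [energyForm_apply, ← h, add_assoc, ← integral_add i2 (integrable_mul_hermiteFun_sq hq n)]
  congr 1
  refine integral_congr_ae (Eventually.of_forall fun x => ?_)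
  simp only [potential]
  ring

/-- Here `√π = ∫ exp(-x²)`, so `ε_n / √π` is the Gaussian average of the gap `ω_n / π - ρ_n`. This
gives both its sign and its role in the trace bound. -/
theorem eps_div_sqrt_pi (n : ℕ) :
    eps n / Real.sqrt Real.pi = omega n / Real.pi * Real.sqrt Real.pi
      - ∫ x, Real.exp (-x ^ 2) * density n x := by
  rw [integral_gaussian_mul_density, eps, sub_div]
  congr 1
  have hp := Real.sqrt_pos.2 Real.pi_pos
  rw [div_mul_eq_mul_div, div_eq_div_iff hp.ne' Real.pi_pos.ne', mul_assoc,
    Real.mul_self_sqrt Real.pi_pos.le]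

theorem integrable_exp_neg_sq : Integrable (fun x : ℝ => Real.exp (-x ^ 2)) volume := by
  simpa using integrable_exp_neg_mul_sq one_pos

theorem integral_exp_neg_sq : ∫ x : ℝ, Real.exp (-x ^ 2) = Real.sqrt Real.pi := by
  simpa using integral_gaussian 1

theorem eps_nonneg (n : ℕ) : 0 ≤ eps n := by
  have hp := Real.sqrt_pos.2 Real.pi_pos
  have h : ∫ x, Real.exp (-x ^ 2) * density n x ≤ omega n / Real.pi * Real.sqrt Real.pi := by
    rw [← integral_exp_neg_sq, ← integral_const_mul]
    refine integral_mono (integrable_gaussian_mul_density n)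
      (integrable_exp_neg_sq.const_mul _) fun x => ?_
    have := mul_le_mul_of_nonneg_right (density_le_omega n x) (Real.exp_pos (-x ^ 2)).le
    simp only
    linarith
  have h2 : 0 ≤ eps n / Real.sqrt Real.pi := by
    rw [eps_div_sqrt_pi]
    linarith
  have := mul_nonneg h2 hp.le
  rwa [div_mul_cancel₀ _ hp.ne'] at this

/-- The upper bound on `ρ_n` may be multiplied only by a nonnegative function, hence `q` is first
completed to `q + qm exp(-x²)`; the mean-zero condition then removes `q` from the right-hand side.
-/
theorem sum_integral_mul_hermiteFun_sq_le (hq : Integrable q volume) (hqm : 0 ≤ qm)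
    (hqpos : ∀ᵐ x, 0 ≤ q x + qm * Real.exp (-x ^ 2)) (hmean : ∫ x, q x = 0) (n : ℕ) :
    ∑ k ∈ Finset.range (n + 1), ∫ x, q x * hermiteFun k x ^ 2 ≤ qm * eps n := by
  have i1 : Integrable (fun x => q x * density n x) volume := by
    simp only [density, Finset.mul_sum]
    exact integrable_finsetSum _ fun k _ => integrable_mul_hermiteFun_sq hq k
  have i2 := integrable_gaussian_mul_density n
  have e1 : ∑ k ∈ Finset.range (n + 1), ∫ x, q x * hermiteFun k x ^ 2
      = ∫ x, q x * density n x := by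
    rw [← integral_finsetSum _ fun k _ => integrable_mul_hermiteFun_sq hq k]
    simp only [density, Finset.mul_sum]
  have h1 : ∫ x, (q x * density n x + qm * (Real.exp (-x ^ 2) * density n x))
      ≤ ∫ x, omega n / Real.pi * (q x + qm * Real.exp (-x ^ 2)) := by
    refine integral_mono_ae (i1.add (i2.const_mul qm))
      ((hq.add (integrable_exp_neg_sq.const_mul qm)).const_mul _) ?_
    filter_upwards [hqpos] with x hx
    have := mul_le_mul_of_nonneg_left (density_le_omega n x) hx
    linarith
  rw [integral_add i1 (i2.const_mul qm), integral_const_mul, integral_const_mul,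
    integral_add hq (integrable_exp_neg_sq.const_mul qm), integral_const_mul, hmean,
    integral_exp_neg_sq, zero_add] at h1
  have h2 : ∫ x, q x * density n x ≤ qm * (eps n / Real.sqrt Real.pi) := by
    rw [eps_div_sqrt_pi]
    linarith
  -- The argument yields the sharper constant `ε_n / √π`; nonnegativity of `ε_n` allows the factor
  -- to be dropped.
  have h3 : eps n / Real.sqrt Real.pi ≤ eps n := by
    refine div_le_self (eps_nonneg n) ?_
    rw [Real.one_le_sqrt]
    linarith [Real.pi_gt_three]
  rw [e1]
  exact h2.trans (mul_le_mul_of_nonneg_left h3 hqm)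

theorem sum_lam_sub_lamZero_le (hq : Integrable q volume) (hqm : 0 ≤ qm)
    (hqpos : ∀ᵐ x, 0 ≤ q x + qm * Real.exp (-x ^ 2)) (hmean : ∫ x, q x = 0) {lam : ℕ → ℝ}
    (hlam : IsEigenvalueSequence (potential q) lam) (n : ℕ) :
    ∑ k ∈ Finset.range (n + 1), (lam k - lamZero k) ≤ qm * eps n := by
  have hV := isConfining_potential hq hqm hqpos
  have h := sum_eigenvalueSequence_le hV hlam
    (ψ := fun k => ⟨hermiteFun k, inFormDomain_hermiteFun hq k⟩)
    (fun i j => integral_hermiteFun_mul i j) n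
  simp only [energyForm_hermiteFun hV hq] at h
  rw [Finset.sum_add_distrib] at h
  rw [Finset.sum_sub_distrib]
  linarith [sum_integral_mul_hermiteFun_sq_le hq hqm hqpos hmean n]

end Perturbation

/-! ### From partial sums of eigenvalues to sums of negative powers -/

/-- Convexity of `x ↦ x^(-s)`. After scaling to `r = x / y`, it follows from `exp t ≥ 1 + t` and
`log r ≤ r - 1`. -/
theorem rpow_neg_ge_tangent {x y s : ℝ} (hx : 0 < x) (hy : 0 < y) (hs : 0 < s) :
    y ^ (-s) - s * (y ^ (-s - 1) * (x - y)) ≤ x ^ (-s) := by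
  have hr : 0 < x / y := div_pos hx hy
  have h1 : 1 - s * (x / y - 1) ≤ (x / y) ^ (-s) := by
    rw [Real.rpow_def_of_pos hr]
    have h2 := Real.add_one_le_exp (Real.log (x / y) * -s)
    have h3 := mul_le_mul_of_nonneg_left (Real.log_le_sub_one_of_pos hr) hs.le
    linarith
  have hys : 0 < y ^ (-s) := Real.rpow_pos_of_pos hy _
  rw [Real.div_rpow hx.le hy.le, le_div_iff₀ hys] at h1
  rw [Real.rpow_sub_one hy.ne']
  refine le_trans (le_of_eq ?_) h1
  field_simp

/-- Summation by parts: a decreasing nonnegative weight preserves the order of partial sums. -/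
theorem sum_mul_le_of_partial_sums_le {w d f : ℕ → ℝ} (hw : Antitone w) (hw0 : ∀ k, 0 ≤ w k)
    (h : ∀ n, ∑ k ∈ Finset.range (n + 1), d k ≤ ∑ k ∈ Finset.range (n + 1), f k) (n : ℕ) :
    ∑ k ∈ Finset.range (n + 1), w k * d k ≤ ∑ k ∈ Finset.range (n + 1), w k * f k := by
  have key : ∀ g : ℕ → ℝ, ∑ k ∈ Finset.range (n + 1), w k * g k
      = w n * ∑ k ∈ Finset.range (n + 1), g k
        + ∑ i ∈ Finset.range n, (w i - w (i + 1)) * ∑ k ∈ Finset.range (i + 1), g k := by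
    intro g
    have := Finset.sum_range_by_parts w g (n + 1)
    simp only [smul_eq_mul, Nat.add_sub_cancel] at this
    rw [this, sub_eq_add_neg, ← Finset.sum_neg_distrib]
    congr 1
    exact Finset.sum_congr rfl fun i _ => by ring
  rw [key, key]
  refine add_le_add (mul_le_mul_of_nonneg_left (h n) (hw0 n)) (Finset.sum_le_sum fun i _ => ?_)
  exact mul_le_mul_of_nonneg_left (h i) (sub_nonneg.2 (hw i.le_succ))

theorem sum_eps_sub_epsPrev (n : ℕ) :
    ∑ k ∈ Finset.range (n + 1), (eps k - epsPrev k) = eps n := by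
  induction n with
  | zero => simp [epsPrev]
  | succ n ih => rw [Finset.sum_range_succ, ih, epsPrev]; ring

end PerturbedOscillator
end

theorem theorem6p3 (q : ℝ → ℝ) (hq : MeasureTheory.Integrable q MeasureTheory.volume)
    (qm : ℝ) (hqm : 0 ≤ qm)
    (hqpos : ∀ᵐ x ∂(MeasureTheory.volume : MeasureTheory.Measure ℝ),
      0 ≤ q x + qm * Real.exp (-x ^ 2))
    (hmean : ∫ x, q x = 0)
    (lam : ℕ → ℝ)
    (hlam : PerturbedOscillator.IsEigenvalueSequence (PerturbedOscillator.potential q) lam)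
    (hlam0 : 0 < lam 0)
    (n : ℕ) (s : ℝ) (hs : 0 < s) :
    ∑ k ∈ Finset.range (n + 1), lam k ^ (-s) ≥
      ∑ k ∈ Finset.range (n + 1), PerturbedOscillator.lamZero k ^ (-s)
        - s * qm * ∑ k ∈ Finset.range (n + 1),
            PerturbedOscillator.lamZero k ^ (-s - 1)
              * (PerturbedOscillator.eps k - PerturbedOscillator.epsPrev k) := by
  have hz : ∀ k, 0 < PerturbedOscillator.lamZero k := fun k => by
    unfold PerturbedOscillator.lamZero
    positivity
  have hl : ∀ k, 0 < lam k := fun k => hlam0.trans_le (hlam.monotone k.zero_le)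
  have hanti : Antitone fun k => PerturbedOscillator.lamZero k ^ (-s - 1) := fun i j hij => by
    refine Real.rpow_le_rpow_of_nonpos (hz i) ?_ (by linarith)
    unfold PerturbedOscillator.lamZero
    have : (i : ℝ) ≤ j := Nat.cast_le.2 hij
    linarith
  -- The increments of `ε` telescope, with `ε_{-1} = 0`, so the partial sums of `f` are exactly the
  -- trace bounds `qm * eps m`.
  have habel := PerturbedOscillator.sum_mul_le_of_partial_sums_le hanti
    (fun k => (Real.rpow_pos_of_pos (hz k) _).le)
    (d := fun k => lam k - PerturbedOscillator.lamZero k)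
    (f := fun k => qm * (PerturbedOscillator.eps k - PerturbedOscillator.epsPrev k))
    (fun m => by
      rw [← Finset.mul_sum, PerturbedOscillator.sum_eps_sub_epsPrev]
      exact PerturbedOscillator.sum_lam_sub_lamZero_le hq hqm hqpos hmean hlam m) n
  have htan := Finset.sum_le_sum fun k (_ : k ∈ Finset.range (n + 1)) =>
    PerturbedOscillator.rpow_neg_ge_tangent (hl k) (hz k) hs
  rw [Finset.sum_sub_distrib, ← Finset.mul_sum] at htan
  simp only [mul_left_comm _ qm, ← Finset.mul_sum] at habel
  have := mul_le_mul_of_nonneg_left habel hs.le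
  linarith
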